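/- Let $U$ be the bilateral shift on $\ell^2(\mathbb Z)$ with canonical basis $(E_k)_{k\in\mathbb Z}$, $UE_k=E_{k+1}$, and for a bounded function $a:\mathbb Z\to\mathbb C$ let $a(\mathbb K)$ be the diagonal operator $a(\mathbb K)E_k=a(k)E_k$. Let $c(\mathbb Z)$ be the set of functions $a:\mathbb Z\to\mathbb C$ for which both limits $\lim_{k\to+\infty}a(k)$ and $\lim_{k\to-\infty}a(k)$ exist (they may differ), and let $c_{00}^{\pm}(\mathbb Z)$ be the set of eventually constant functions, i.e. those that are constant for $k\ge k_0$ and constant for $k\le -k_0$, for some $k_0\in\mathbb N$ (the two constants may differ). The quantum cylinder is the C$^*$-algebra $$A=C^*\bigl(U,\ a(\mathbb K)\,:\,a\in c(\mathbb Z)\bigr)\subseteq B(\ell^2(\mathbb Z)),$$ $\mathcal A\subseteq A$ is the subalgebra of all finite sums $\sum_n U^n a_n(\mathbb K)$ with $n\in\mathbb Z$ and $a_n\in c_{00}^{\pm}(\mathbb Z)$, and $\mathcal K$ is the ideal of compact operators in $A$. Write $[a]$ for the class of $a$ in $A/\mathcal K$, and $[\mathcal A]=\{[a]:a\in\mathcal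 A\}$. A derivation $d:\mathcal A\to A$ is a $\mathbb C$-linear map with $d(ab)=d(a)b+a\,d(b)$ for all $a,b\in\mathcal A$ (no continuity is assumed). Every such $d$ maps $\mathcal A\cap\mathcal K$ to $\mathcal K$ and so induces a derivation $[d]:[\mathcal A]\to A/\mathcal K$, $[d]([a])=[d(a)]$. The derivation $d$ is called approximately inner if there is a sequence $(a_n)$ in $A$ such that $d(a)=\lim_{n\to\infty}(a_na-aa_n)$ in norm for every $a\in\mathcal A$. **Theorem.** Let $d:\mathcal A\to A$ be any derivation. Then $[d]=0$ if and only if $d$ is approximately inner. Consequently, if $d_1,d_2:\mathcal A\to A$ are derivations with $[d_1]=[d_2]$, then $d_1-d_2$ is approximately inner. -/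

import Mathlib

open Filter Topology
open scoped ENNReal lp Pointwise

noncomputable section

namespace QuantumCylinder

/-- The Hilbert space `ℓ²(ℤ)`. -/
abbrev Hilb : Type := ℓ²(ℤ, ℂ)

/-- Bounded operators on `ℓ²(ℤ)`, with the operator norm and the adjoint as star operation. -/
abbrev Op : Type := Hilb →L[ℂ] Hilb

/-- Bounded functions `ℤ → ℂ`. -/
abbrev BddSeq : Type := ℓ^∞(ℤ, ℂ)

/-! ### The canonical basis, diagonal operators and the bilateral shift -/

/-- The canonical basis vector `E k` of `ℓ²(ℤ)`. -/
def E (k : ℤ) : Hilb := lp.single 2 k (1 : ℂ)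

theorem E_apply (k i : ℤ) : (E k : ℤ → ℂ) i = if i = k then 1 else 0 := by
  rw [E, lp.single_apply]
  simp [Pi.single_apply]

theorem norm_E (k : ℤ) : ‖E k‖ = 1 := by
  rw [E, lp.norm_single (by norm_num)]
  simp

theorem op_ext {x y : Op} (h : ∀ k, x (E k) = y (E k)) : x = y := by
  refine lp.ext_continuousLinearMap (by norm_num) (fun k => ?_)
  ext1
  exact h k

theorem norm_mul_le (a : BddSeq) (f : Hilb) (k : ℤ) : ‖a k * f k‖ ≤ ‖((‖a‖ : ℂ) • f) k‖ := by
  rw [lp.coeFn_smul, Pi.smul_apply, norm_smul, norm_mul, Complex.norm_real, norm_norm]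
  exact mul_le_mul_of_nonneg_right (lp.norm_apply_le_norm (by simp) a k) (norm_nonneg _)

theorem diag_memℓp (a : BddSeq) (f : Hilb) : Memℓp (fun k => a k * f k) 2 :=
  Memℓp.mono (memℓp_norm_iff.mpr (lp.memℓp ((‖a‖ : ℂ) • f))) (norm_mul_le a f)

/-- The diagonal operator `a(𝕂)`, for a bounded function `a : ℤ → ℂ`:
`(a(𝕂) f)(k) = a(k) f(k)`, that is `a(𝕂) E k = a(k) E k`. -/
def diag (a : BddSeq) : Op :=
  LinearMap.mkContinuous
    { toFun := fun f => ⟨fun k => a k * f k, diag_memℓp a f⟩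
      map_add' := fun f g => by
        ext k; exact mul_add (a k) (f k) (g k)
      map_smul' := fun c f => by
        ext k; exact mul_left_comm (a k) c (f k) }
    ‖a‖
    (fun f => by
      refine (lp.norm_mono (y := (‖a‖ : ℂ) • f) (by norm_num) (norm_mul_le a f)).trans_eq ?_
      rw [norm_smul, Complex.norm_real, norm_norm])

theorem diag_apply (a : BddSeq) (f : Hilb) (k : ℤ) : (diag a f : ℤ → ℂ) k = a k * f k := rfl

theorem diag_E (a : BddSeq) (k : ℤ) : diag a (E k) = a k • E k := by
  ext i
  rw [diag_apply, lp.coeFn_smul, Pi.smul_apply, smul_eq_mul, E_apply]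
  split_ifs with h
  · rw [h]
  · simp

theorem shift_memℓp (f : Hilb) (m : ℤ) : Memℓp (fun k => f (k + m)) 2 := by
  have hf := (lp.memℓp f).summable (by norm_num)
  refine memℓp_gen ?_
  exact hf.comp_injective (i := fun k : ℤ => k + m) (add_left_injective m)

/-- The bilateral shift on `ℓ²(ℤ)` as an isometric isomorphism, `(U f)(k) = f(k - 1)`. -/
def shiftIso : Hilb ≃ₗᵢ[ℂ] Hilb where
  toFun f := ⟨fun k => f (k + -1), shift_memℓp f (-1)⟩
  invFun f := ⟨fun k => f (k + 1), shift_memℓp f 1⟩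
  map_add' _ _ := rfl
  map_smul' _ _ := rfl
  left_inv f := by ext k; exact congrArg (f : ℤ → ℂ) (by ring : k + 1 + -1 = k)
  right_inv f := by ext k; exact congrArg (f : ℤ → ℂ) (by ring : k + -1 + 1 = k)
  norm_map' f := by
    rw [lp.norm_eq_tsum_rpow (by norm_num), lp.norm_eq_tsum_rpow (by norm_num)]
    congr 1
    exact (Equiv.addRight (-1 : ℤ)).tsum_eq (fun k => ‖f k‖ ^ (2 : ℝ≥0∞).toReal)

/-- The bilateral shift `U`, `U E k = E (k + 1)`, as a unitary operator; so `U ^ n` makes sense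
for every integer `n`. -/
def U : unitary Op := Unitary.linearIsometryEquiv.symm shiftIso

theorem U_apply (f : Hilb) (k : ℤ) : ((U : Op) f : ℤ → ℂ) k = f (k - 1) := rfl

theorem U_inv_apply (f : Hilb) (k : ℤ) : (((U⁻¹ : unitary Op) : Op) f : ℤ → ℂ) k = f (k + 1) := by
  have h : ((U : Op) (((U⁻¹ : unitary Op) : Op) f) : ℤ → ℂ) (k + 1) = f (k + 1) := by
    have : (U : Op) * ((U⁻¹ : unitary Op) : Op) = 1 := by
      rw [← Submonoid.coe_mul, mul_inv_cancel]; rfl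
    change (((U : Op) * ((U⁻¹ : unitary Op) : Op)) f : ℤ → ℂ) (k + 1) = _
    rw [this]; rfl
  rw [U_apply] at h
  simpa using h

theorem U_zpow_apply (n : ℤ) (f : Hilb) (k : ℤ) :
    (((U ^ n : unitary Op) : Op) f : ℤ → ℂ) k = f (k - n) := by
  induction n generalizing f k with
  | zero => simp
  | succ n ih =>
    rw [zpow_add_one, Submonoid.coe_mul, mul_apply_eq_comp, ih, U_apply]
    exact congrArg (f : ℤ → ℂ) (by ring)
  | pred n ih =>
    rw [zpow_sub_one, Submonoid.coe_mul, mul_apply_eq_comp, ih, U_inv_apply]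
    exact congrArg (f : ℤ → ℂ) (by ring)

theorem U_zpow_E (n k : ℤ) : ((U ^ n : unitary Op) : Op) (E k) = E (k + n) := by
  ext i
  rw [U_zpow_apply, E_apply, E_apply]
  exact if_congr (by constructor <;> intro h <;> linarith) rfl rfl

/-! ### The quantum cylinder and its dense subalgebra -/

/-- The space `c(ℤ)` of functions that converge at `+∞` and at `-∞` (to possibly different
limits). -/
def c : Set BddSeq :=
  {a | (∃ l : ℂ, Tendsto (fun k : ℤ => a k) atTop (𝓝 l)) ∧
       (∃ l : ℂ, Tendsto (fun k : ℤ => a k) atBot (𝓝 l))}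

/-- The space `c₀₀^±(ℤ)` of eventually constant functions (the values near `+∞` and near `-∞`
may differ). -/
def cEv : Set BddSeq :=
  {a | ∃ k₀ : ℕ, ∃ p q : ℂ, (∀ k : ℤ, (k₀ : ℤ) ≤ k → a k = p) ∧ (∀ k : ℤ, k ≤ -(k₀ : ℤ) → a k = q)}

theorem cEv_subset_c : cEv ⊆ c := by
  rintro a ⟨k₀, p, q, hp, hq⟩
  refine ⟨⟨p, ?_⟩, ⟨q, ?_⟩⟩
  · exact tendsto_const_nhds.congr' ((eventually_ge_atTop (k₀ : ℤ)).mono fun k hk => (hp k hk).symm)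
  · exact tendsto_const_nhds.congr' ((eventually_le_atBot (-(k₀ : ℤ))).mono
      fun k hk => (hq k hk).symm)

/-- The quantum cylinder `A = C*(A_diag, U)`: the C*-algebra of operators on `ℓ²(ℤ)` generated by
`U` and the diagonal operators `a(𝕂)` with `a ∈ c(ℤ)`. -/
def A : StarSubalgebra ℂ Op :=
  (StarAlgebra.adjoin ℂ (insert (U : Op) (diag '' c))).topologicalClosure

/-- The monomials `Uⁿ a(𝕂)`, `n ∈ ℤ`, with `a` eventually constant. -/
def monomials : Set Op :=
  {x | ∃ n : ℤ, ∃ a ∈ cEv, x = ((U ^ n : unitary Op) : Op) * diag a}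

theorem monomials_mul : monomials * monomials ⊆ monomials := by
  rintro _ ⟨_, ⟨m, a, ⟨k₀, p, q, hp, hq⟩, rfl⟩, _, ⟨n, b, ⟨k₁, p', q', hp', hq'⟩, rfl⟩, rfl⟩
  have hmem : Memℓp (fun k : ℤ => a (k + n) * b k) ∞ := by
    refine memℓp_infty ⟨‖a‖ * ‖b‖, ?_⟩
    rintro _ ⟨k, rfl⟩
    change ‖a (k + n) * b k‖ ≤ _
    rw [norm_mul]
    exact mul_le_mul (lp.norm_apply_le_norm (by simp) a _) (lp.norm_apply_le_norm (by simp) b _)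
      (norm_nonneg _) (norm_nonneg _)
  refine ⟨m + n, ⟨_, hmem⟩, ⟨k₀ + k₁ + n.natAbs, p * p', q * q', ?_, ?_⟩, ?_⟩
  · intro k hk
    change a (k + n) * b k = _
    rw [hp _ (by omega), hp' _ (by omega)]
  · intro k hk
    change a (k + n) * b k = _
    rw [hq _ (by omega), hq' _ (by omega)]
  · refine op_ext fun k => ?_
    simp only [mul_apply_eq_comp, diag_E, map_smul, U_zpow_E, smul_smul]
    change _ = (a (k + n) * b k) • _
    rw [mul_comm, add_assoc, add_comm n m]

theorem one_mem_monomials : (1 : Op) ∈ monomials := by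
  refine ⟨0, 1, ⟨0, 1, 1, fun _ _ => rfl, fun _ _ => rfl⟩, op_ext fun k => ?_⟩
  simp [diag_E]

/-- The dense subalgebra `𝒜` of `A`: all finite sums `∑ₙ Uⁿ aₙ(𝕂)` with `aₙ` eventually
constant. -/
def Apol : Subalgebra ℂ Op :=
  (Submodule.span ℂ monomials).toSubalgebra (Submodule.subset_span one_mem_monomials)
    (fun x y hx hy => by
      have h := Submodule.mul_mem_mul hx hy
      rw [Submodule.span_mul_span] at h
      exact Submodule.span_mono monomials_mul h)

theorem Apol_le_A : Apol ≤ A.toSubalgebra := by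
  intro x hx
  refine Submodule.span_induction (p := fun x _ => x ∈ A) ?_ (zero_mem A)
    (fun _ _ _ _ => add_mem) (fun r _ _ h => A.smul_mem h r) hx
  rintro _ ⟨n, a, ha, rfl⟩
  have hle := StarSubalgebra.le_topologicalClosure
    (StarAlgebra.adjoin ℂ (insert (U : Op) (diag '' c)))
  have hU : (U : Op) ∈ A := hle (StarAlgebra.subset_adjoin ℂ _ (Set.mem_insert _ _))
  refine mul_mem ?_ (hle (StarAlgebra.subset_adjoin ℂ _
    (Set.mem_insert_of_mem _ ⟨a, cEv_subset_c ha, rfl⟩)))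
  obtain ⟨m, rfl | rfl⟩ := n.eq_nat_or_neg
  · rw [zpow_natCast, SubmonoidClass.coe_pow]
    exact pow_mem hU m
  · rw [zpow_neg, zpow_natCast, ← Unitary.star_eq_inv, Unitary.coe_star, SubmonoidClass.coe_pow]
    exact star_mem (pow_mem hU m)

/-- The inclusion `𝒜 ⊆ A`. -/
def incl : Apol →ₐ[ℂ] A := Subalgebra.inclusion Apol_le_A

/-- The ideal `𝒦` of compact operators in `A`. -/
def K : Ideal A where
  carrier := {x | IsCompactOperator (x : Op)}
  zero_mem' := isCompactOperator_zero
  add_mem' := fun hx hy => IsCompactOperator.add hx hy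
  smul_mem' := fun y _ hx => IsCompactOperator.clm_comp hx (y : Op)

theorem mem_K {x : A} : x ∈ K ↔ IsCompactOperator (x : Op) := Iff.rfl

theorem coe_A_mul (x y : A) : ((x * y : A) : Op) = (x : Op) ∘L (y : Op) := rfl

theorem K_mul_mem {x y : A} (hx : x ∈ K) : x * y ∈ K := by
  rw [mem_K] at hx ⊢
  rw [coe_A_mul, ContinuousLinearMap.coe_comp]
  exact hx.comp_clm (y : Op)

instance K_isTwoSided : K.IsTwoSided := ⟨fun _ hx => K_mul_mem hx⟩

/-! ### Derivations -/

/-- A derivation from a (noncommutative) algebra `B` to an algebra `C` that contains `B` by means of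
the homomorphism `φ`: a `ℂ`-linear map with `d(ab) = d(a) b + a d(b)`. -/
structure Deriv {B C : Type} [Ring B] [Algebra ℂ B] [Ring C] [Algebra ℂ C] (φ : B →ₐ[ℂ] C)
    extends B →ₗ[ℂ] C where
  leibniz' : ∀ a b : B, toFun (a * b) = toFun a * φ b + φ a * toFun b

namespace Deriv

variable {B C : Type} [Ring B] [Algebra ℂ B] [Ring C] [Algebra ℂ C] {φ : B →ₐ[ℂ] C}

instance : CoeFun (Deriv φ) (fun _ => B → C) := ⟨fun d => d.toLinearMap⟩

theorem leibniz (d : Deriv φ) (a b : B) : d (a * b) = d a * φ b + φ a * d b := d.leibniz' a b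

instance : Zero (Deriv φ) where
  zero := { (0 : B →ₗ[ℂ] C) with leibniz' := fun a b => by simp }

instance : Sub (Deriv φ) where
  sub d₁ d₂ :=
    { d₁.toLinearMap - d₂.toLinearMap with
      leibniz' := fun a b => by
        change d₁ (a * b) - d₂ (a * b) = (d₁ a - d₂ a) * φ b + φ a * (d₁ b - d₂ b)
        rw [leibniz, leibniz, sub_mul, mul_sub]
        abel }

theorem zero_apply (a : B) : (0 : Deriv φ) a = 0 := rfl

theorem sub_apply (d₁ d₂ : Deriv φ) (a : B) : (d₁ - d₂) a = d₁ a - d₂ a := rfl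

theorem ext {d₁ d₂ : Deriv φ} (h : ∀ a, d₁ a = d₂ a) : d₁ = d₂ := by
  cases d₁; cases d₂
  congr 1
  exact LinearMap.ext h

/-! The passage to the quotient. Let `I` be a two-sided ideal of `C` and let `[B]` be the image of
`B` in `C/I`. If `d` maps `φ⁻¹(I)` to `I`, it induces a derivation `[B] → C/I`. -/

/-- The homomorphism `B → C/I`, `a ↦ [φ a]`; its range is `[B]`. -/
def cls (φ : B →ₐ[ℂ] C) (I : Ideal C) [I.IsTwoSided] : B →ₐ[ℂ] C ⧸ I :=
  (Ideal.Quotient.mkₐ ℂ I).comp φ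

variable (I : Ideal C) [I.IsTwoSided]

theorem cls_surjective : Function.Surjective (cls φ I).rangeRestrict.toLinearMap :=
  (cls φ I).rangeRestrict_surjective

variable (d : Deriv φ) (h : ∀ x, φ x ∈ I → d x ∈ I)

theorem ker_le (h : ∀ x, φ x ∈ I → d x ∈ I) :
    LinearMap.ker (cls φ I).rangeRestrict.toLinearMap ≤
      LinearMap.ker ((Ideal.Quotient.mkₐ ℂ I).toLinearMap ∘ₗ d.toLinearMap) :=
  fun x hx => Ideal.Quotient.eq_zero_iff_mem.mpr
    (h x (Ideal.Quotient.eq_zero_iff_mem.mp (congrArg Subtype.val hx)))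

/-- The linear map `[B] → C/I`, `[a] ↦ [d a]`. -/
def quotLin : (cls φ I).range →ₗ[ℂ] C ⧸ I :=
  (Submodule.liftQ (LinearMap.ker (cls φ I).rangeRestrict.toLinearMap)
    ((Ideal.Quotient.mkₐ ℂ I).toLinearMap ∘ₗ d.toLinearMap) (ker_le I d h)) ∘ₗ
  (LinearMap.quotKerEquivOfSurjective _ (cls_surjective I)).symm.toLinearMap

theorem quotLin_cls (a : B) :
    quotLin I d h ((cls φ I).rangeRestrict a) = Ideal.Quotient.mk I (d a) := by
  have e : (LinearMap.quotKerEquivOfSurjective _ (cls_surjective (φ := φ) I)).symm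
      ((cls φ I).rangeRestrict.toLinearMap a) = Submodule.Quotient.mk a := by
    rw [LinearEquiv.symm_apply_eq]
    rfl
  change Submodule.liftQ _ _ (ker_le I d h) ((LinearMap.quotKerEquivOfSurjective _
    (cls_surjective (φ := φ) I)).symm ((cls φ I).rangeRestrict.toLinearMap a)) = _
  rw [e]
  rfl

/-- The induced derivation `[B] → C/I`, `[a] ↦ [d a]`. -/
def quot : Deriv (cls φ I).range.val where
  toLinearMap := quotLin I d h
  leibniz' y z := by
    obtain ⟨a, rfl⟩ := (cls φ I).rangeRestrict_surjective y
    obtain ⟨b, rfl⟩ := (cls φ I).rangeRestrict_surjective z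
    change quotLin I d h ((cls φ I).rangeRestrict a * (cls φ I).rangeRestrict b) =
      quotLin I d h ((cls φ I).rangeRestrict a) * Ideal.Quotient.mk I (φ b) +
      Ideal.Quotient.mk I (φ a) * quotLin I d h ((cls φ I).rangeRestrict b)
    rw [← map_mul, quotLin_cls, quotLin_cls, quotLin_cls, d.leibniz, map_add, map_mul, map_mul]

end Deriv

/-- A derivation `d : 𝒜 → A` is approximately inner if there are `aₙ ∈ A` such that
`d(a) = lim [aₙ, a]` in norm for every `a ∈ 𝒜`. -/
def IsApproxInner (d : Deriv incl) : Prop :=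
  ∃ s : ℕ → A, ∀ a : Apol, Tendsto (fun n => s n * incl a - incl a * s n) atTop (𝓝 (d a))

/-! ### The induced derivation `[d] : [𝒜] → A/𝒦` -/

/-- The matrix coefficients of an element of `𝒜` are eventually constant along diagonals. -/
theorem exists_coeff_const {x : Op} (hx : x ∈ Apol) :
    ∃ N : ℕ, ∀ j k : ℤ,
      ((N : ℤ) ≤ k → (x (E k) : ℤ → ℂ) (k + j) = (x (E N) : ℤ → ℂ) (N + j)) ∧
      (k ≤ -(N : ℤ) → (x (E k) : ℤ → ℂ) (k + j) = (x (E (-N)) : ℤ → ℂ) (-N + j)) := by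
  have key : ∃ N : ℕ, ∀ j k l : ℤ,
      ((N : ℤ) ≤ k → (N : ℤ) ≤ l → (x (E k) : ℤ → ℂ) (k + j) = (x (E l) : ℤ → ℂ) (l + j)) ∧
      (k ≤ -(N : ℤ) → l ≤ -(N : ℤ) →
        (x (E k) : ℤ → ℂ) (k + j) = (x (E l) : ℤ → ℂ) (l + j)) := by
    refine Submodule.span_induction (p := fun x _ => ∃ N : ℕ, ∀ j k l : ℤ,
      ((N : ℤ) ≤ k → (N : ℤ) ≤ l → (x (E k) : ℤ → ℂ) (k + j) = (x (E l) : ℤ → ℂ) (l + j)) ∧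
      (k ≤ -(N : ℤ) → l ≤ -(N : ℤ) →
        (x (E k) : ℤ → ℂ) (k + j) = (x (E l) : ℤ → ℂ) (l + j))) ?_ ?_ ?_ ?_ hx
    · rintro _ ⟨n, a, ⟨k₀, p, q, hp, hq⟩, rfl⟩
      refine ⟨k₀, fun j k l => ?_⟩
      simp only [mul_apply_eq_comp, diag_E, map_smul, U_zpow_E, lp.coeFn_smul,
        Pi.smul_apply, E_apply, smul_eq_mul, add_right_inj]
      exact ⟨fun hk hl => by rw [hp k hk, hp l hl], fun hk hl => by rw [hq k hk, hq l hl]⟩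
    · exact ⟨0, fun j k l => ⟨fun _ _ => rfl, fun _ _ => rfl⟩⟩
    · rintro x y _ _ ⟨N, hN⟩ ⟨M, hM⟩
      refine ⟨N + M, fun j k l => ⟨fun hk hl => ?_, fun hk hl => ?_⟩⟩
      · exact congrArg₂ (· + ·) ((hN j k l).1 (by omega) (by omega))
          ((hM j k l).1 (by omega) (by omega))
      · exact congrArg₂ (· + ·) ((hN j k l).2 (by omega) (by omega))
          ((hM j k l).2 (by omega) (by omega))
    · rintro r x _ ⟨N, hN⟩
      refine ⟨N, fun j k l => ⟨fun hk hl => ?_, fun hk hl => ?_⟩⟩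
      · exact congrArg (r * ·) ((hN j k l).1 hk hl)
      · exact congrArg (r * ·) ((hN j k l).2 hk hl)
  obtain ⟨N, hN⟩ := key
  exact ⟨N, fun j k => ⟨fun hk => (hN j k N).1 hk le_rfl, fun hk => (hN j k (-N)).2 hk le_rfl⟩⟩

/-- If a compact operator has constant matrix coefficients along a diagonal, far out, then the
constant is zero. -/
theorem coeff_eq_zero_of_compact {x : Op} (hx : IsCompactOperator x) (u : ℕ → ℤ)
    (hu : Tendsto u atTop cofinite) (v : ℕ → ℤ) (z : ℂ)
    (hz : ∀ n, (x (E (u n)) : ℤ → ℂ) (v n) = z) : z = 0 := by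
  obtain ⟨C, hC, hsub⟩ := hx.image_closedBall_subset_compact (f := (x : Hilb →ₗ[ℂ] Hilb)) 1
  obtain ⟨y, -, φ, hφ, hy⟩ := hC.tendsto_subseq (x := fun n => x (E (u n)))
    (fun n => hsub ⟨E (u n), by simp [norm_E], rfl⟩)
  have hcoord : ∀ i : ℤ, Tendsto (fun n => (x (E (u n)) : ℤ → ℂ) i) atTop (𝓝 0) := by
    intro i
    have hs := (lp.memℓp (ContinuousLinearMap.adjoint x (E i))).summable (by norm_num)
    have h0 := (hs.tendsto_cofinite_zero).comp hu
    have h1 : Tendsto (fun n => ‖ContinuousLinearMap.adjoint x (E i) (u n)‖) atTop (𝓝 0) := by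
      have h2 := h0.sqrt
      rw [Real.sqrt_zero] at h2
      refine h2.congr fun n => ?_
      simp [Real.sqrt_sq]
    refine squeeze_zero_norm (fun n => le_of_eq ?_) h1
    have e1 : inner ℂ (E i) (x (E (u n))) = (x (E (u n)) : ℤ → ℂ) i := by
      rw [E, lp.inner_single_left]
      simp
    have e2 : inner ℂ (ContinuousLinearMap.adjoint x (E i)) (E (u n)) =
        star (ContinuousLinearMap.adjoint x (E i) (u n)) := by
      rw [E, E, lp.inner_single_right]
      simp
    rw [← e1, ← ContinuousLinearMap.adjoint_inner_left, e2, norm_star]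
  have hy0 : y = 0 := by
    ext i
    refine tendsto_nhds_unique ?_ ((hcoord i).comp hφ.tendsto_atTop)
    exact ((lp.evalCLM ℂ (fun _ : ℤ => ℂ) 2 i).continuous.tendsto y).comp hy
  rw [hy0] at hy
  have hn := hy.norm
  rw [norm_zero] at hn
  have : ‖z‖ ≤ 0 := by
    refine ge_of_tendsto hn (Eventually.of_forall fun n => ?_)
    change ‖z‖ ≤ ‖x (E (u (φ n)))‖
    rw [← hz (φ n)]
    exact lp.norm_apply_le_norm (by norm_num) _ _
  simpa using this

/-- The indicator function of `{k : |k| < N}`. -/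
def cut (N : ℕ) : BddSeq :=
  ∑ i ∈ Finset.Ioo (-(N : ℤ)) N, lp.single ∞ i (1 : ℂ)

theorem cut_apply (N : ℕ) (k : ℤ) :
    (cut N : ℤ → ℂ) k = if -(N : ℤ) < k ∧ k < N then 1 else 0 := by
  rw [cut, lp.coeFn_sum, Finset.sum_apply]
  simp [lp.single_apply, Pi.single_apply]

theorem diag_cut_mem (N : ℕ) : diag (cut N) ∈ Apol := by
  refine Submodule.subset_span ⟨0, cut N, ⟨N, 0, 0, fun k hk => ?_, fun k hk => ?_⟩, by simp⟩
  · rw [cut_apply, if_neg (by omega)]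
  · rw [cut_apply, if_neg (by omega)]

theorem diag_cut_compact (N : ℕ) : IsCompactOperator (diag (cut N)) := by
  have h : diag (cut N) = ∑ i ∈ Finset.Ioo (-(N : ℤ)) N,
      (lp.singleContinuousLinearMap ℂ (fun _ : ℤ => ℂ) 2 i).comp
        (lp.evalCLM ℂ (fun _ : ℤ => ℂ) 2 i) := by
    refine op_ext fun k => ?_
    ext j
    rw [sum_apply, lp.coeFn_sum, Finset.sum_apply, diag_apply, cut_apply,
      E_apply]
    have e : ∀ i : ℤ, ((lp.singleContinuousLinearMap ℂ (fun _ : ℤ => ℂ) 2 i).comp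
        (lp.evalCLM ℂ (fun _ : ℤ => ℂ) 2 i) (E k) : ℤ → ℂ) j =
        if j = i then (if j = k then 1 else 0) else 0 := by
      intro i
      change (lp.single 2 i ((E k : ℤ → ℂ) i) : ℤ → ℂ) j = _
      rw [lp.single_apply, E_apply, Pi.single_apply]
      split_ifs <;> simp_all
    simp only [e]
    rw [Finset.sum_ite_eq]
    simp only [Finset.mem_Ioo, ite_mul, one_mul, zero_mul]
  rw [h]
  refine (compactOperator (RingHom.id ℂ) Hilb Hilb).sum_mem fun i _ => ?_
  exact IsCompactOperator.clm_comp
    (isCompactOperator_of_locallyCompactSpace_dom (lp.evalCLM ℂ (fun _ : ℤ => ℂ) 2 i))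
    (lp.singleContinuousLinearMap ℂ (fun _ : ℤ => ℂ) 2 i)

/-- A derivation `d : 𝒜 → A` maps `𝒜 ∩ 𝒦` to `𝒦`. -/
theorem deriv_mem_K (d : Deriv incl) {x : Apol} (hx : incl x ∈ K) : d x ∈ K := by
  obtain ⟨N, hN⟩ := exists_coeff_const x.2
  have hc : IsCompactOperator (x : Op) := hx
  have hxE : ∀ k : ℤ, ((N : ℤ) ≤ k ∨ k ≤ -(N : ℤ)) → (x : Op) (E k) = 0 := by
    intro k hk
    ext i
    change ((x : Op) (E k) : ℤ → ℂ) i = 0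
    have hi : i = k + (i - k) := by ring
    rw [hi]
    rcases hk with hk | hk
    · rw [(hN (i - k) k).1 hk]
      refine coeff_eq_zero_of_compact hc (fun n => N + n) ?_ (fun n => N + n + (i - k)) _
        (fun n => (hN (i - k) (N + n)).1 (by omega))
      rw [← Nat.cofinite_eq_atTop]
      exact Function.Injective.tendsto_cofinite fun a b h => by simpa using h
    · rw [(hN (i - k) k).2 hk]
      refine coeff_eq_zero_of_compact hc (fun n => -N - n) ?_ (fun n => -N - n + (i - k)) _
        (fun n => (hN (i - k) (-N - n)).2 (by omega))
      rw [← Nat.cofinite_eq_atTop]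
      exact Function.Injective.tendsto_cofinite fun a b h => by simpa using h
  let Q : Apol := ⟨diag (cut N), diag_cut_mem N⟩
  have hQ : incl Q ∈ K := diag_cut_compact N
  have hxQ : x * Q = x := by
    refine Subtype.ext (op_ext fun k => ?_)
    change (x : Op) (diag (cut N) (E k)) = (x : Op) (E k)
    rw [diag_E, map_smul, cut_apply]
    split_ifs with h
    · rw [one_smul]
    · rw [zero_smul, hxE k (by omega)]
  rw [← hxQ, d.leibniz]
  exact K.add_mem (K.mul_mem_left _ hQ) (K.mul_mem_right _ hx)

/-- The image `[𝒜]` of `𝒜` in `A/𝒦`. -/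
abbrev ApolCls : Subalgebra ℂ (A ⧸ K) := (Deriv.cls incl K).range

/-- The class `[a] ∈ [𝒜]` of `a ∈ 𝒜`. -/
def toCls : Apol →ₐ[ℂ] ApolCls := (Deriv.cls incl K).rangeRestrict

/-- The derivation `[d] : [𝒜] → A/𝒦` induced by `d : 𝒜 → A`. -/
def induced (d : Deriv incl) : Deriv ApolCls.val :=
  Deriv.quot K d (fun _ hx => deriv_mem_K d hx)

theorem induced_apply (d : Deriv incl) (a : Apol) :
    induced d (toCls a) = Ideal.Quotient.mk K (d a) :=
  Deriv.quotLin_cls K d (fun _ hx => deriv_mem_K d hx) a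

end QuantumCylinder

end

/-! Since `[d] = 0` means that `d` takes compact values, the task is to show that these derivations
are exactly the approximately inner ones. One direction holds because `A/𝒦` is commutative: all
commutators in `A` are compact, and so are their norm limits (`commutator_mem_K`).

Conversely, applying `d` to matrix units produces an infinite matrix `t`, possibly unbounded, with
`d(x) = tx - xt` entrywise for `x = U` and `x` diagonal (`coef_deriv`). The problem is to truncate
`t` to elements of `𝒜` whose commutators converge in norm. Let `T_i` be the block of `t` on the
window `[i, i + M)`, and average these blocks with weights `tent N i / M`. The commutator of this
average with a diagonal `b` is exactly the same average of compressions of the compact `d(b)`; at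
most `M` windows overlap, so such averages are contractions and tend to the identity on compact
operators (`tendsto_windowAvg`).

For `U` there is an additional error from moving the tent by one step, at most `1/N` times the size
of the blocks. Compactness of `U⁻¹ d(U)` makes `‖T_i‖` grow sublinearly in `i`
(`exists_norm_block_le`), so the error vanishes once `N` is large in terms of `M`. No condition on
`N` depends on `b`, so one sequence serves `U` and all diagonals, hence all of `𝒜`. -/

noncomputable section

namespace QuantumCylinder

/-! ### Matrix coefficients, matrix units and coordinate projections -/

/-- The matrix coefficient `⟨E j, x E k⟩` of an operator. -/
def coef (x : Op) (j k : ℤ) : ℂ := (x (E k) : ℤ → ℂ) j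

theorem coef_ext {x y : Op} (h : ∀ j k, coef x j k = coef y j k) : x = y :=
  op_ext fun k => lp.ext (funext fun j => h j k)

@[simp] theorem coef_zero (j k : ℤ) : coef 0 j k = 0 := rfl

@[simp] theorem coef_add (x y : Op) (j k : ℤ) : coef (x + y) j k = coef x j k + coef y j k := rfl

@[simp] theorem coef_sub (x y : Op) (j k : ℤ) : coef (x - y) j k = coef x j k - coef y j k := rfl

@[simp] theorem coef_smul (r : ℂ) (x : Op) (j k : ℤ) : coef (r • x) j k = r * coef x j k := rfl

theorem coef_sum {ι : Type*} (s : Finset ι) (x : ι → Op) (j k : ℤ) :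
    coef (∑ i ∈ s, x i) j k = ∑ i ∈ s, coef (x i) j k := by
  rw [coef, sum_apply, lp.coeFn_sum, Finset.sum_apply]
  rfl

@[simp] theorem coef_diag_mul (a : BddSeq) (x : Op) (j k : ℤ) :
    coef (diag a * x) j k = a j * coef x j k := rfl

@[simp] theorem coef_mul_diag (x : Op) (a : BddSeq) (j k : ℤ) :
    coef (x * diag a) j k = a k * coef x j k := by
  rw [coef, mul_apply_eq_comp, diag_E, map_smul]
  rfl

@[simp] theorem coef_zpow_mul (n : ℤ) (x : Op) (j k : ℤ) :
    coef (((U ^ n : unitary Op) : Op) * x) j k = coef x (j - n) k :=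
  U_zpow_apply n (x (E k)) j

@[simp] theorem coef_mul_zpow (n : ℤ) (x : Op) (j k : ℤ) :
    coef (x * ((U ^ n : unitary Op) : Op)) j k = coef x j (k + n) := by
  rw [coef, mul_apply_eq_comp, U_zpow_E]
  rfl

/-- The matrix unit with the coefficient `1` at `(j, k)`. -/
def matUnit (j k : ℤ) : Op := ((U ^ (j - k) : unitary Op) : Op) * diag (lp.single ∞ k (1 : ℂ))

theorem matUnit_mem (j k : ℤ) : matUnit j k ∈ Apol := by
  refine Submodule.subset_span ⟨j - k, _, ⟨k.natAbs + 1, 0, 0, fun l hl => ?_, fun l hl => ?_⟩, rfl⟩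
  · rw [lp.single_apply, Pi.single_apply, if_neg (by omega)]
  · rw [lp.single_apply, Pi.single_apply, if_neg (by omega)]

theorem matUnit_E (j k l : ℤ) : matUnit j k (E l) = if l = k then E j else 0 := by
  rw [matUnit, mul_apply_eq_comp, diag_E, map_smul, U_zpow_E, lp.single_apply, Pi.single_apply]
  split_ifs with h
  · rw [h, one_smul, add_sub_cancel]
  · rw [zero_smul]

@[simp] theorem coef_matUnit (j k j' k' : ℤ) :
    coef (matUnit j k) j' k' = if j' = j ∧ k' = k then 1 else 0 := by
  rw [coef, matUnit_E]
  by_cases h : k' = k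
  · simp [h, E_apply]
  · simp [h]

/-- The indicator function of a finite set of integers. -/
def ind (s : Finset ℤ) : BddSeq :=
  ⟨fun k => if k ∈ s then 1 else 0, memℓp_infty ⟨1, by
    rintro _ ⟨k, rfl⟩
    dsimp only
    split_ifs <;> simp⟩⟩

theorem ind_apply (s : Finset ℤ) (k : ℤ) : ind s k = if k ∈ s then (1 : ℂ) else 0 := rfl

/-- The projection onto the span of the `E k` with `k ∈ s`. -/
def proj (s : Finset ℤ) : Op := diag (ind s)

theorem proj_apply (s : Finset ℤ) (f : Hilb) (k : ℤ) :
    (proj s f : ℤ → ℂ) k = if k ∈ s then f k else 0 := by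
  rw [proj, diag_apply, ind_apply, ite_mul, one_mul, zero_mul]

@[simp] theorem coef_proj_mul (s : Finset ℤ) (x : Op) (j k : ℤ) :
    coef (proj s * x) j k = if j ∈ s then coef x j k else 0 :=
  proj_apply s (x (E k)) j

@[simp] theorem coef_mul_proj (s : Finset ℤ) (x : Op) (j k : ℤ) :
    coef (x * proj s) j k = if k ∈ s then coef x j k else 0 := by
  rw [proj, coef_mul_diag, ind_apply, ite_mul, one_mul, zero_mul]

theorem norm_proj_apply_le (s : Finset ℤ) (f : Hilb) : ‖proj s f‖ ≤ ‖f‖ := by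
  refine lp.norm_mono (by norm_num) fun k => ?_
  rw [proj_apply]
  split_ifs
  · exact le_rfl
  · simp

theorem norm_proj_le (s : Finset ℤ) : ‖proj s‖ ≤ 1 :=
  ContinuousLinearMap.opNorm_le_bound _ zero_le_one fun f => by
    rw [one_mul]; exact norm_proj_apply_le s f

theorem norm_one_sub_proj_apply_le (s : Finset ℤ) (f : Hilb) : ‖(1 - proj s) f‖ ≤ ‖f‖ := by
  refine lp.norm_mono (by norm_num) fun k => ?_
  change ‖f k - (proj s f : ℤ → ℂ) k‖ ≤ _
  rw [proj_apply]
  split_ifs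
  · simp
  · simp

theorem norm_one_sub_proj_le (s : Finset ℤ) : ‖1 - proj s‖ ≤ 1 :=
  ContinuousLinearMap.opNorm_le_bound _ zero_le_one fun f => by
    rw [one_mul]; exact norm_one_sub_proj_apply_le s f

theorem star_proj (s : Finset ℤ) : star (proj s) = proj s := by
  rw [ContinuousLinearMap.star_eq_adjoint, eq_comm, ContinuousLinearMap.eq_adjoint_iff]
  intro f g
  rw [lp.inner_eq_tsum, lp.inner_eq_tsum]
  refine tsum_congr fun k => ?_
  rw [proj_apply, proj_apply]
  split_ifs <;> simp

theorem norm_compress_le (s : Finset ℤ) (x : Op) : ‖proj s * x * proj s‖ ≤ ‖x‖ :=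
  calc ‖proj s * x * proj s‖ ≤ ‖proj s‖ * ‖x‖ * ‖proj s‖ :=
        (_root_.norm_mul_le _ _).trans (mul_le_mul_of_nonneg_right (_root_.norm_mul_le _ _) (norm_nonneg _))
    _ ≤ 1 * ‖x‖ * 1 := by gcongr <;> exact norm_proj_le s
    _ = ‖x‖ := by ring

theorem compress_eq_sum (s : Finset ℤ) (x : Op) :
    proj s * x * proj s = ∑ j ∈ s, ∑ k ∈ s, coef x j k • matUnit j k := by
  refine coef_ext fun j k => ?_
  simp only [coef_sum, coef_mul_proj, coef_proj_mul, coef_smul, coef_matUnit, ite_and, mul_ite,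
    mul_one, mul_zero]
  rw [Finset.sum_comm]
  by_cases hj : j ∈ s <;> simp [hj]

/-! ### Approximation of compact operators -/

theorem tendsto_proj_apply (f : Hilb) : Tendsto (fun s => proj s f) atTop (𝓝 f) := by
  refine (lp.hasSum_single (by norm_num) f).congr fun s => ?_
  ext k
  rw [lp.coeFn_sum, Finset.sum_apply, proj_apply]
  simp [lp.single_apply, Pi.single_apply]

/-- The image of the unit ball has a finite `ε/4`-net. The projections converge on the finitely many
points of the net, and `1 - proj s` is a contraction on the remainder. -/
theorem tendsto_proj_mul {x : Op} (hx : IsCompactOperator x) :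
    Tendsto (fun s => proj s * x) atTop (𝓝 x) := by
  obtain ⟨C, hC, hsub⟩ := hx.image_closedBall_subset_compact (f := (x : Hilb →ₗ[ℂ] Hilb)) 1
  rw [tendsto_iff_norm_sub_tendsto_zero, Metric.tendsto_nhds]
  intro ε hε
  obtain ⟨t, -, ht, hcov⟩ := hC.finite_cover_balls (e := ε / 4) (by positivity)
  have hev : ∀ᶠ s in atTop, ∀ y ∈ t, ‖y - proj s y‖ < ε / 4 := by
    rw [Filter.eventually_all_finite ht]
    intro y _
    have h := Metric.tendsto_nhds.1 (tendsto_proj_apply y) (ε / 4) (by positivity)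
    refine h.mono fun s hs => ?_
    rwa [dist_comm, dist_eq_norm] at hs
  refine hev.mono fun s hs => ?_
  rw [Real.dist_eq, sub_zero, abs_norm, norm_sub_rev]
  refine lt_of_le_of_lt (b := ε / 2) ?_ (by linarith)
  refine ContinuousLinearMap.opNorm_le_of_unit_norm (by positivity) fun f hf => ?_
  have hm := hcov (hsub ⟨f, by simp [hf], rfl⟩)
  simp only [Set.mem_iUnion, Metric.mem_ball, exists_prop] at hm
  obtain ⟨y, hy, hd⟩ := hm
  rw [dist_eq_norm] at hd
  change ‖x f - proj s (x f)‖ ≤ _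
  have e : x f - proj s (x f) = (1 - proj s) (x f - y) + (y - proj s y) := by
    rw [map_sub]
    change _ = (x f - proj s (x f)) - (y - proj s y) + _
    abel
  rw [e]
  have h1 := norm_one_sub_proj_apply_le s (x f - y)
  have h2 := norm_add_le ((1 - proj s) (x f - y)) (y - proj s y)
  have h3 := hs y hy
  have h4 : ‖x f - y‖ < ε / 4 := hd
  linarith

/-- The C*-identity reduces this to left multiplication, applied to the compact operator `star x *
x`. -/
theorem tendsto_mul_proj {x : Op} (hx : IsCompactOperator x) :
    Tendsto (fun s => x * proj s) atTop (𝓝 x) := by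
  have hc : IsCompactOperator (star x * x : Op) := IsCompactOperator.clm_comp hx (star x)
  have h0 : Tendsto (fun s => ‖proj s * (star x * x) - star x * x‖) atTop (𝓝 0) :=
    tendsto_iff_norm_sub_tendsto_zero.1 (tendsto_proj_mul hc)
  have h1 := h0.sqrt
  rw [Real.sqrt_zero] at h1
  rw [tendsto_iff_norm_sub_tendsto_zero]
  refine squeeze_zero (fun _ => norm_nonneg _) (fun s => ?_) h1
  refine Real.le_sqrt_of_sq_le ?_
  have e : star (x * proj s - x) * (x * proj s - x) =
      (proj s * (star x * x) - star x * x) * (proj s - 1) := by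
    rw [star_sub, star_mul, star_proj]
    noncomm_ring
  rw [sq, ← CStarRing.norm_star_mul_self, e]
  refine (_root_.norm_mul_le _ _).trans (mul_le_of_le_one_right (norm_nonneg _) ?_)
  rw [norm_sub_rev]
  exact norm_one_sub_proj_le s

theorem compact_mem_closure_span {x : Op} (hx : IsCompactOperator x) :
    x ∈ closure (Submodule.span ℂ {y | ∃ j k, y = matUnit j k} : Set Op) := by
  have h : Tendsto (fun s => proj s * x * proj s) atTop (𝓝 x) := by
    have h1 : Tendsto (fun s => proj s * (x * proj s - x)) atTop (𝓝 0) := by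
      refine squeeze_zero_norm (fun s => ?_)
        (tendsto_iff_norm_sub_tendsto_zero.1 (tendsto_mul_proj hx))
      exact (_root_.norm_mul_le _ _).trans
        (mul_le_of_le_one_left (norm_nonneg _) (norm_proj_le s))
    have h2 := h1.add (tendsto_proj_mul hx)
    rw [zero_add] at h2
    refine h2.congr fun s => ?_
    noncomm_ring
  refine mem_closure_of_tendsto h (Eventually.of_forall fun s => ?_)
  rw [compress_eq_sum]
  exact Submodule.sum_mem _ fun j _ => Submodule.sum_mem _ fun k _ =>
    Submodule.smul_mem _ _ (Submodule.subset_span ⟨j, k, rfl⟩)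

/-- A uniformly bounded family of linear maps that tends to zero on the matrix units tends to zero
on every compact operator. -/
theorem tendsto_zero_of_matUnit {ι : Type*} {l : Filter ι} (L : ι → Op →ₗ[ℂ] Op) (C : ℝ)
    (hC : ∀ i x, ‖L i x‖ ≤ C * ‖x‖) (hL : ∀ j k, Tendsto (fun i => L i (matUnit j k)) l (𝓝 0))
    {x : Op} (hx : IsCompactOperator x) : Tendsto (fun i => L i x) l (𝓝 0) := by
  have hspan : ∀ y ∈ Submodule.span ℂ {y | ∃ j k, y = matUnit j k},
      Tendsto (fun i => L i y) l (𝓝 0) := by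
    intro y hy
    refine Submodule.span_induction ?_ ?_ ?_ ?_ hy
    · rintro _ ⟨j, k, rfl⟩; exact hL j k
    · simpa using tendsto_const_nhds
    · intro y z _ _ h1 h2
      simpa using h1.add h2
    · intro r y _ h
      simpa using h.const_smul r
  rw [Metric.tendsto_nhds]
  intro ε hε
  -- The `+ 1` keeps the denominator positive when `C = 0`.
  obtain ⟨y, hy, hxy⟩ := Metric.mem_closure_iff.1 (compact_mem_closure_span hx)
    (ε / (2 * (|C| + 1))) (by positivity)
  refine (Metric.tendsto_nhds.1 (hspan y hy) (ε / 2) (by positivity)).mono fun i hi => ?_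
  rw [dist_zero_right] at hi ⊢
  have e : L i x = L i (x - y) + L i y := by rw [map_sub, sub_add_cancel]
  rw [dist_eq_norm, lt_div_iff₀ (by positivity)] at hxy
  have h1 : ‖L i (x - y)‖ ≤ |C| * ‖x - y‖ :=
    (hC i _).trans (mul_le_mul_of_nonneg_right (le_abs_self C) (norm_nonneg _))
  have h2 := norm_nonneg (x - y)
  rw [e]
  refine (norm_add_le _ _).trans_lt ?_
  nlinarith

/-! ### Sums of compressions with bounded overlap -/

theorem norm_proj_apply_sq (s : Finset ℤ) (f : Hilb) : ‖proj s f‖ ^ 2 = ∑ k ∈ s, ‖f k‖ ^ 2 := by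
  have h := lp.norm_rpow_eq_tsum (p := 2) (by norm_num) (proj s f)
  simp only [ENNReal.toReal_ofNat, Real.rpow_ofNat] at h
  rw [h, tsum_eq_sum (s := s) fun k hk => by rw [proj_apply, if_neg hk]; simp]
  exact Finset.sum_congr rfl fun k hk => by rw [proj_apply, if_pos hk]

/-- After exchanging the sums, each coordinate of `f` is counted at most `M` times. -/
theorem sum_norm_proj_sq_le {ι : Type*} (I : Finset ι) (s : ι → Finset ℤ) (M : ℕ)
    (hM : ∀ k, (I.filter (k ∈ s ·)).card ≤ M) (f : Hilb) :
    ∑ i ∈ I, ‖proj (s i) f‖ ^ 2 ≤ M * ‖f‖ ^ 2 := by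
  classical
  let t := I.biUnion s
  have e : ∀ i ∈ I, ‖proj (s i) f‖ ^ 2 = ∑ k ∈ t, if k ∈ s i then ‖f k‖ ^ 2 else 0 := by
    intro i hi
    rw [norm_proj_apply_sq, ← Finset.sum_filter]
    refine Finset.sum_congr (Finset.ext fun k => ?_) fun _ _ => rfl
    rw [Finset.mem_filter, Finset.mem_biUnion]
    exact ⟨fun h => ⟨⟨i, hi, h⟩, h⟩, fun h => h.2⟩
  rw [Finset.sum_congr rfl e, Finset.sum_comm]
  calc _ ≤ ∑ k ∈ t, (M : ℝ) * ‖f k‖ ^ 2 := by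
        refine Finset.sum_le_sum fun k _ => ?_
        rw [← Finset.sum_filter, Finset.sum_const, nsmul_eq_mul]
        exact mul_le_mul_of_nonneg_right (by exact_mod_cast hM k) (by positivity)
    _ ≤ _ := by
        rw [← Finset.mul_sum, ← norm_proj_apply_sq]
        have := norm_proj_apply_le t f
        gcongr

/-- The bound involves only the overlap `M`, not the number of summands. With `g` the image of `f`,
expand `⟨g, g⟩` and apply Cauchy–Schwarz to the norms `‖proj (s i) g‖` and `‖proj (s i) f‖`. -/
theorem norm_sum_compress_le {ι : Type*} (I : Finset ι) (s : ι → Finset ℤ) (M : ℕ)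
    (hM : ∀ k, (I.filter (k ∈ s ·)).card ≤ M) (y : ι → Op) (C : ℝ) (hC : 0 ≤ C)
    (hy : ∀ i ∈ I, ‖y i‖ ≤ C) :
    ‖∑ i ∈ I, proj (s i) * y i * proj (s i)‖ ≤ M * C := by
  refine ContinuousLinearMap.opNorm_le_bound _ (by positivity) fun f => ?_
  set g := (∑ i ∈ I, proj (s i) * y i * proj (s i)) f with hg
  have h1 : ‖g‖ ^ 2 ≤ C * ∑ i ∈ I, ‖proj (s i) g‖ * ‖proj (s i) f‖ := by
    have e : (inner ℂ g g : ℂ) = ∑ i ∈ I, inner ℂ (proj (s i) g) (y i (proj (s i) f)) := by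
      conv_lhs => rhs; rw [hg]
      rw [sum_apply, inner_sum]
      refine Finset.sum_congr rfl fun i _ => ?_
      conv_rhs => rw [← ContinuousLinearMap.adjoint_inner_right,
        ← ContinuousLinearMap.star_eq_adjoint, star_proj]
      rfl
    have e2 : ‖g‖ ^ 2 = ‖(inner ℂ g g : ℂ)‖ := by
      rw [inner_self_eq_norm_sq_to_K]; simp
    rw [e2, e, Finset.mul_sum]
    refine (norm_sum_le _ _).trans (Finset.sum_le_sum fun i hi => ?_)
    refine (norm_inner_le_norm _ _).trans ?_
    have h := (y i).le_of_opNorm_le (hy i hi) (proj (s i) f)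
    calc _ ≤ ‖proj (s i) g‖ * (C * ‖proj (s i) f‖) := by gcongr
      _ = _ := by ring
  have h2 : (∑ i ∈ I, ‖proj (s i) g‖ * ‖proj (s i) f‖) ≤ M * (‖g‖ * ‖f‖) := by
    have hcs := Finset.sum_mul_sq_le_sq_mul_sq I (fun i => ‖proj (s i) g‖) fun i => ‖proj (s i) f‖
    have hg2 := sum_norm_proj_sq_le I s M hM g
    have hf2 := sum_norm_proj_sq_le I s M hM f
    refine abs_le_of_sq_le_sq' ?_ (by positivity) |>.2
    refine hcs.trans ((mul_le_mul hg2 hf2 (Finset.sum_nonneg fun _ _ => by positivity)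
      (by positivity)).trans_eq ?_)
    ring
  rcases (norm_nonneg g).eq_or_lt with h0 | h0
  · rw [← h0]; positivity
  · have h3 : ‖g‖ * ‖g‖ ≤ ‖g‖ * (M * C * ‖f‖) := by nlinarith [mul_le_mul_of_nonneg_left h2 hC]
    exact le_of_mul_le_mul_left h3 h0

/-! ### Averages of compressions to windows -/

/-- The tent function of width `N` and height `1`. -/
def tent (N : ℕ) (i : ℤ) : ℝ := max 0 (1 - |(i : ℝ)| / N)

theorem tent_nonneg (N : ℕ) (i : ℤ) : 0 ≤ tent N i := le_max_left _ _

theorem tent_le_one (N : ℕ) (i : ℤ) : tent N i ≤ 1 :=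
  max_le zero_le_one (sub_le_self _ (by positivity))

theorem le_tent (N : ℕ) (i : ℤ) : 1 - |(i : ℝ)| / N ≤ tent N i := le_max_right _ _

theorem tent_self {N : ℕ} (hN : 0 < N) : tent N N = 0 := by
  have : (N : ℝ) ≠ 0 := by positivity
  simp [tent, this]

theorem tent_neg_self {N : ℕ} (hN : 0 < N) : tent N (-N) = 0 := by
  have : (N : ℝ) ≠ 0 := by positivity
  simp [tent, this]

theorem abs_tent_sub_le (N : ℕ) (i : ℤ) : |tent N (i + 1) - tent N i| ≤ 1 / N := by
  refine (abs_max_sub_max_le_max _ _ _ _).trans (max_le (by simp) ?_)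
  have e : 1 - |((i + 1 : ℤ) : ℝ)| / N - (1 - |(i : ℝ)| / N) =
      (|(i : ℝ)| - |((i + 1 : ℤ) : ℝ)|) / N := by ring
  rw [e, abs_div, Nat.abs_cast]
  refine div_le_div_of_nonneg_right ((abs_abs_sub_abs_le_abs_sub _ _).trans ?_) (by positivity)
  push_cast
  rw [sub_add_cancel_left, abs_neg, abs_one]

/-- The window `[i, i + M)`. -/
def window (M : ℕ) (i : ℤ) : Finset ℤ := Finset.Ico i (i + M)

theorem mem_window {M : ℕ} {i k : ℤ} : k ∈ window M i ↔ i ≤ k ∧ k < i + M := Finset.mem_Ico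

theorem add_one_mem_window {M : ℕ} {i k : ℤ} : k + 1 ∈ window M (i + 1) ↔ k ∈ window M i := by
  rw [mem_window, mem_window]; omega

theorem card_filter_mem_window_le (I : Finset ℤ) (M : ℕ) (k : ℤ) :
    (I.filter (k ∈ window M ·)).card ≤ M := by
  have h : I.filter (k ∈ window M ·) ⊆ Finset.Ioc (k - M) k := fun i hi => by
    rw [Finset.mem_filter, mem_window] at hi
    rw [Finset.mem_Ioc]; omega
  refine (Finset.card_le_card h).trans_eq ?_
  rw [Int.card_Ioc]; omega

theorem norm_tent_div_smul_le (M N : ℕ) (i : ℤ) (x : Op) :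
    ‖((tent N i / M : ℝ) : ℂ) • x‖ ≤ ‖x‖ / M := by
  rw [norm_smul, Complex.norm_real, Real.norm_of_nonneg (div_nonneg (tent_nonneg _ _)
    (by positivity)), div_mul_eq_mul_div]
  exact div_le_div_of_nonneg_right (mul_le_of_le_one_left (norm_nonneg _) (tent_le_one _ _))
    (by positivity)

/-- The average of the compressions of an operator to windows of length `M`, weighted by a tent
function of width `N`. -/
def windowAvg (M N : ℕ) : Op →ₗ[ℂ] Op where
  toFun x := ∑ i ∈ Finset.Ico (-(N : ℤ)) N,
    ((tent N i / M : ℝ) : ℂ) • (proj (window M i) * x * proj (window M i))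
  map_add' x y := by simp only [mul_add, add_mul, smul_add, Finset.sum_add_distrib]
  map_smul' r x := by
    simp only [mul_smul_comm, smul_mul_assoc, RingHom.id_apply, Finset.smul_sum]
    exact Finset.sum_congr rfl fun i _ => smul_comm _ _ _

theorem windowAvg_apply (M N : ℕ) (x : Op) :
    windowAvg M N x = ∑ i ∈ Finset.Ico (-(N : ℤ)) N,
      ((tent N i / M : ℝ) : ℂ) • (proj (window M i) * x * proj (window M i)) := rfl

/-- The factor `1/M` in the weights cancels the overlap of the windows. -/
theorem norm_windowAvg_le {M : ℕ} (hM : 0 < M) (N : ℕ) (x : Op) : ‖windowAvg M N x‖ ≤ ‖x‖ := by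
  have h := norm_sum_compress_le (Finset.Ico (-(N : ℤ)) N) (window M) M
    (card_filter_mem_window_le _ M) (fun i => ((tent N i / M : ℝ) : ℂ) • x) (‖x‖ / M)
    (by positivity) fun i _ => norm_tent_div_smul_le M N i x
  rw [mul_div_cancel₀ _ (by positivity)] at h
  simpa only [windowAvg_apply, mul_smul_comm, smul_mul_assoc] using h

theorem compress_matUnit (s : Finset ℤ) (j k : ℤ) :
    proj s * matUnit j k * proj s = if j ∈ s ∧ k ∈ s then matUnit j k else 0 := by
  refine coef_ext fun j' k' => ?_
  rw [apply_ite (fun x => coef x j' k')]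
  simp only [coef_mul_proj, coef_proj_mul, coef_matUnit, coef_zero]
  split_ifs <;> simp_all

theorem windowAvg_matUnit (M N : ℕ) (j k : ℤ) :
    windowAvg M N (matUnit j k) = ((∑ i ∈ (Finset.Ico (-(N : ℤ)) N).filter
      fun i => j ∈ window M i ∧ k ∈ window M i, tent N i / M : ℝ) : ℂ) • matUnit j k := by
  rw [windowAvg_apply, Complex.ofReal_sum, Finset.sum_smul, Finset.sum_filter]
  refine Finset.sum_congr rfl fun i _ => ?_
  rw [compress_matUnit]
  split_ifs <;> simp

/-- This is the eigenvalue of `windowAvg` at a matrix unit. With `c = |j| + |k|` and `u = 1/(m +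
1)`, at least `m + 1 - c` windows contain both indices, which costs `c u`. Their starting points
satisfy `|i| ≤ m + 1 + c`, where the tent falls short of `1` by at most `(m + 1 + c)/N ≤ (1 + c) u`.
The total is `(1 + 2c) u`. -/
theorem abs_weight_sub_one_le {m N : ℕ} (hN : (m + 1) ^ 2 ≤ N) {j k : ℤ}
    (hm : j.natAbs + k.natAbs ≤ m) :
    |(∑ i ∈ (Finset.Ico (-(N : ℤ)) N).filter
      fun i => j ∈ window (m + 1) i ∧ k ∈ window (m + 1) i, tent N i / (m + 1 : ℕ)) - 1| ≤
    (1 + 2 * (j.natAbs + k.natAbs : ℕ)) * (1 / ((m : ℝ) + 1)) := by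
  set c := j.natAbs + k.natAbs with hc
  set F := (Finset.Ico (-(N : ℤ)) N).filter
    fun i => j ∈ window (m + 1) i ∧ k ∈ window (m + 1) i with hF
  have hm1 : (0 : ℝ) < (m : ℝ) + 1 := by positivity
  have hNR : ((m : ℝ) + 1) ^ 2 ≤ N := by exact_mod_cast hN
  have hN0 : (0 : ℝ) < N := lt_of_lt_of_le (by positivity) hNR
  have hcm : (c : ℝ) ≤ m := by exact_mod_cast hm
  have hc0 : (0 : ℝ) ≤ c := by positivity
  have hmN : m + 1 + c ≤ N := by nlinarith
  have hup : ∑ i ∈ F, tent N i / (m + 1 : ℕ) ≤ 1 := by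
    have hcard : (F.card : ℝ) ≤ (m + 1 : ℕ) := by
      refine Nat.cast_le.2 (le_trans (Finset.card_le_card ?_)
        (card_filter_mem_window_le (Finset.Ico (-(N : ℤ)) N) (m + 1) j))
      exact Finset.monotone_filter_right _ fun i _ h => h.1
    calc _ ≤ ∑ i ∈ F, 1 / ((m + 1 : ℕ) : ℝ) := Finset.sum_le_sum fun i _ =>
          div_le_div_of_nonneg_right (tent_le_one N i) (by positivity)
      _ = F.card / (m + 1 : ℕ) := by rw [Finset.sum_const, nsmul_eq_mul, mul_one_div]
      _ ≤ 1 := (div_le_one (by positivity)).2 hcard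
  have hlow : (((m : ℝ) + 1 - c) / (m + 1)) * (1 - ((m : ℝ) + 1 + c) / N) ≤
      ∑ i ∈ F, tent N i / (m + 1 : ℕ) := by
    set S := Finset.Ioc (max j k - (m + 1 : ℕ)) (min j k) with hS
    have hSF : S ⊆ F := fun i hi => by
      rw [hS, Finset.mem_Ioc] at hi
      rw [hF, Finset.mem_filter, Finset.mem_Ico, mem_window, mem_window]
      omega
    have hpos : 0 ≤ 1 - ((m : ℝ) + 1 + c) / N := by
      rw [sub_nonneg, div_le_one hN0]; exact_mod_cast hmN
    have hcard : (m : ℝ) + 1 - c ≤ S.card := by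
      have : m + 1 ≤ S.card + c := by rw [hS, Int.card_Ioc]; omega
      have : (m : ℝ) + 1 ≤ S.card + c := by exact_mod_cast this
      linarith
    calc _ ≤ S.card / ((m : ℝ) + 1) * (1 - ((m : ℝ) + 1 + c) / N) := by gcongr
      _ = ∑ i ∈ S, (1 - ((m : ℝ) + 1 + c) / N) / (m + 1 : ℕ) := by
          rw [Finset.sum_const, nsmul_eq_mul]; push_cast; ring
      _ ≤ ∑ i ∈ S, tent N i / (m + 1 : ℕ) := by
          refine Finset.sum_le_sum fun i hi => div_le_div_of_nonneg_right
            (le_trans ?_ (le_tent N i)) (by positivity)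
          have hi' : i.natAbs ≤ m + 1 + c := by
            rw [hS, Finset.mem_Ioc] at hi; omega
          have : |(i : ℝ)| ≤ (m : ℝ) + 1 + c := by
            rw [← Int.cast_abs, Int.abs_eq_natAbs]; exact_mod_cast hi'
          gcongr
      _ ≤ _ := Finset.sum_le_sum_of_subset_of_nonneg hSF fun i _ _ =>
          div_nonneg (tent_nonneg N i) (by positivity)
  rw [abs_sub_comm, abs_of_nonneg (by linarith)]
  set u := 1 / ((m : ℝ) + 1) with hu
  have hu0 : 0 < u := by positivity
  have hum : ((m : ℝ) + 1) * u = 1 := by rw [hu]; field_simp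
  have hu1 : u ≤ 1 := by rw [hu, div_le_one hm1]; linarith
  have h1 : ((m : ℝ) + 1 - c) / (m + 1) = 1 - c * u := by rw [hu]; field_simp
  have h2 : ((m : ℝ) + 1 + c) / N ≤ (1 + c) * u := by
    calc ((m : ℝ) + 1 + c) / N ≤ ((m : ℝ) + 1 + c) / ((m : ℝ) + 1) ^ 2 := by gcongr
      _ = u + c * (u * u) := by rw [hu]; field_simp
      _ ≤ u + c * (u * 1) := by gcongr
      _ = _ := by ring
  have h3 : 0 ≤ ((m : ℝ) + 1 + c) / N := by positivity
  rw [h1] at hlow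
  have h4 : 0 ≤ c * u * (((m : ℝ) + 1 + c) / N) := by positivity
  nlinarith

theorem tendsto_windowAvg {N : ℕ → ℕ} (hN : ∀ m, (m + 1) ^ 2 ≤ N m) {x : Op}
    (hx : IsCompactOperator x) :
    Tendsto (fun m => windowAvg (m + 1) (N m) x) atTop (𝓝 x) := by
  have h := tendsto_zero_of_matUnit (l := atTop)
    (fun m => windowAvg (m + 1) (N m) - LinearMap.id) 2 (fun m y => ?_) (fun j k => ?_) hx
  · refine tendsto_sub_nhds_zero_iff.1 (h.congr fun m => rfl)
  · refine (norm_sub_le _ _).trans ?_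
    have := norm_windowAvg_le (Nat.succ_pos m) (N m) y
    rw [LinearMap.id_apply]
    simp only [Nat.succ_eq_add_one] at this
    linarith
  · have hlim := (tendsto_one_div_add_atTop_nhds_zero_nat (𝕜 := ℝ)).const_mul
      ((1 + 2 * (j.natAbs + k.natAbs : ℕ)) * ‖matUnit j k‖ : ℝ)
    rw [mul_zero] at hlim
    refine squeeze_zero_norm' ?_ hlim
    filter_upwards [eventually_ge_atTop (j.natAbs + k.natAbs)] with m hm
    rw [LinearMap.sub_apply, windowAvg_matUnit, LinearMap.id_apply]
    nth_rewrite 2 [← one_smul ℂ (matUnit j k)]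
    rw [← sub_smul, norm_smul, ← Complex.ofReal_one, ← Complex.ofReal_sub, Complex.norm_real,
      Real.norm_eq_abs]
    calc _ ≤ _ := mul_le_mul_of_nonneg_right (abs_weight_sub_one_le (hN m) hm) (norm_nonneg _)
      _ = _ := by ring

/-- On a matrix unit the compression vanishes for all but finitely many windows; compressions are
contractive, so this passes to compact operators. -/
theorem tendsto_compress_window {x : Op} (hx : IsCompactOperator x) (M : ℕ) :
    Tendsto (fun i => proj (window M i) * x * proj (window M i)) cofinite (𝓝 0) := by
  refine tendsto_zero_of_matUnit (fun i =>
    { toFun := fun x => proj (window M i) * x * proj (window M i)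
      map_add' := fun x y => by rw [mul_add, add_mul]
      map_smul' := fun r x => by
        rw [mul_smul_comm, smul_mul_assoc, RingHom.id_apply] }) 1
    (fun i y => by rw [one_mul]; exact norm_compress_le _ y) (fun j k => ?_) hx
  refine tendsto_nhds_of_eventually_eq ?_
  refine Filter.eventually_cofinite.2 ((Finset.Ioc (j - M) j).finite_toSet.subset fun i hi => ?_)
  by_contra hj
  refine hi ?_
  change proj (window M i) * matUnit j k * proj (window M i) = 0
  rw [compress_matUnit, if_neg]
  rw [Finset.mem_coe, Finset.mem_Ioc] at hj
  rw [mem_window]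
  omega

/-! ### Finite blocks of an infinite matrix -/

/-- The block of the infinite matrix `t` with rows and columns in `s`. -/
def block (t : ℤ → ℤ → ℂ) (s : Finset ℤ) : Op := ∑ j ∈ s, ∑ k ∈ s, t j k • matUnit j k

theorem block_mem (t : ℤ → ℤ → ℂ) (s : Finset ℤ) : block t s ∈ Apol :=
  sum_mem fun _ _ => sum_mem fun _ _ => Apol.smul_mem (matUnit_mem _ _) _

@[simp] theorem coef_block (t : ℤ → ℤ → ℂ) (s : Finset ℤ) (j k : ℤ) :
    coef (block t s) j k = if j ∈ s ∧ k ∈ s then t j k else 0 := by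
  simp only [block, coef_sum, coef_smul, coef_matUnit, ite_and, mul_ite, mul_one, mul_zero]
  rw [Finset.sum_comm]
  by_cases hj : j ∈ s <;> simp [hj]

theorem norm_zpow_mul (n : ℤ) (x : Op) : ‖((U ^ n : unitary Op) : Op) * x‖ = ‖x‖ :=
  CStarRing.norm_coe_unitary_mul _ x

theorem norm_mul_zpow (n : ℤ) (x : Op) : ‖x * ((U ^ n : unitary Op) : Op)‖ = ‖x‖ :=
  CStarRing.norm_mul_coe_unitary x _

/-- Conjugation by the shift, `x ↦ U⁻¹ x U`. -/
def conjU (x : Op) : Op := ((U ^ (-1 : ℤ) : unitary Op) : Op) * x * ((U ^ (1 : ℤ) : unitary Op) : Op)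

@[simp] theorem coef_conjU (x : Op) (j k : ℤ) : coef (conjU x) j k = coef x (j + 1) (k + 1) := by
  rw [conjU, coef_mul_zpow, coef_zpow_mul, sub_neg_eq_add]

theorem norm_conjU (x : Op) : ‖conjU x‖ = ‖x‖ := by
  rw [conjU, norm_mul_zpow, norm_zpow_mul]

theorem conjU_block_sub {t : ℤ → ℤ → ℂ} {x : Op}
    (hx : ∀ j k, coef x j k = t (j + 1) (k + 1) - t j k) (M : ℕ) (i : ℤ) :
    conjU (block t (window M (i + 1))) - block t (window M i) =
      proj (window M i) * x * proj (window M i) := by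
  refine coef_ext fun j k => ?_
  simp only [coef_sub, coef_conjU, coef_block, coef_mul_proj, coef_proj_mul, add_one_mem_window, hx]
  split_ifs <;> simp_all

/-- This puts the error terms into the form of compressions that `norm_sum_compress_le` requires. -/
theorem compress_conjU_block (t : ℤ → ℤ → ℂ) (M : ℕ) (i : ℤ) :
    proj (window M i) * conjU (block t (window M (i + 1))) * proj (window M i) =
      conjU (block t (window M (i + 1))) := by
  refine coef_ext fun j k => ?_
  simp only [coef_conjU, coef_block, coef_mul_proj, coef_proj_mul, add_one_mem_window]
  split_ifs <;> simp_all

/-- Increments that tend to zero force sublinear growth: outside a finite interval each step adds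
less than `ε`, and `C` absorbs the interval. -/
theorem exists_le_mul_abs_add {b g : ℤ → ℝ} (hb : ∀ i, |b (i + 1) - b i| ≤ g i)
    (hg : Tendsto g cofinite (𝓝 0)) {ε : ℝ} (hε : 0 < ε) :
    ∃ C, 0 ≤ C ∧ ∀ i : ℤ, b i ≤ ε * |(i : ℝ)| + C := by
  have hfin : {i | ¬ g i < ε}.Finite := by
    have := hg.eventually (gt_mem_nhds hε)
    exact Filter.eventually_cofinite.1 this
  obtain ⟨R, hR⟩ : ∃ R : ℕ, ∀ i : ℤ, R ≤ i.natAbs → g i < ε := by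
    -- This sum exceeds `|l|` for every exceptional index `l`.
    refine ⟨∑ l ∈ hfin.toFinset, (l.natAbs + 1), fun i hi => ?_⟩
    by_contra h
    have hmem : i ∈ hfin.toFinset := by simpa using h
    have := Finset.single_le_sum (f := fun l : ℤ => l.natAbs + 1) (fun _ _ => Nat.zero_le _) hmem
    omega
  set I := Finset.Icc (-(R + 1 : ℤ)) R with hI
  have hC0 : 0 ≤ ∑ i ∈ I, |b i| := Finset.sum_nonneg fun _ _ => abs_nonneg _
  have hCI : ∀ i ∈ I, b i ≤ ∑ i ∈ I, |b i| := fun i hi => (le_abs_self _).trans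
    (Finset.single_le_sum (f := fun i => |b i|) (fun _ _ => abs_nonneg _) hi)
  refine ⟨∑ i ∈ I, |b i|, hC0, fun i => ?_⟩
  rcases le_total (R : ℤ) i with h | h
  · refine Int.leInduction (m := (R : ℤ)) (motive := fun i _ =>
      b i ≤ ε * |(i : ℝ)| + ∑ i ∈ I, |b i|) ?_ ?_ i h
    · have := hCI R (by rw [hI, Finset.mem_Icc]; omega)
      have : 0 ≤ ε * |((R : ℤ) : ℝ)| := by positivity
      linarith
    · intro n hn ih
      have h1 := (abs_le.1 (hb n)).2
      have h2 := hR n (by omega)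
      have hn0 : (0 : ℝ) ≤ n := by exact_mod_cast (by omega : (0 : ℤ) ≤ n)
      rw [abs_of_nonneg hn0] at ih
      push_cast
      rw [abs_of_nonneg (by linarith)]
      linarith
  rcases le_total (-(R + 1 : ℤ)) i with h' | h'
  · have := hCI i (by rw [hI, Finset.mem_Icc]; omega)
    have : 0 ≤ ε * |(i : ℝ)| := by positivity
    linarith
  · refine Int.leInductionDown (m := (-(R + 1 : ℤ))) (motive := fun i _ =>
      b i ≤ ε * |(i : ℝ)| + ∑ i ∈ I, |b i|) ?_ ?_ i h'
    · have := hCI (-(R + 1 : ℤ)) (by rw [hI, Finset.mem_Icc]; omega)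
      have : 0 ≤ ε * |((-(R + 1 : ℤ) : ℤ) : ℝ)| := by positivity
      linarith
    · intro n hn ih
      have h1 := (abs_le.1 (hb (n - 1))).1
      rw [sub_add_cancel] at h1
      have h2 := hR (n - 1) (by omega)
      have hn0 : (n : ℝ) ≤ 0 := by exact_mod_cast (by omega : n ≤ 0)
      rw [abs_of_nonpos hn0] at ih
      push_cast
      rw [abs_of_nonpos (by linarith)]
      linarith

/-- Conjugation by `U` is isometric, so neighbouring blocks differ in norm by at most the norm of a
compression of `x`, which tends to zero. -/
theorem exists_norm_block_le {t : ℤ → ℤ → ℂ} {x : Op} (hc : IsCompactOperator x)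
    (hx : ∀ j k, coef x j k = t (j + 1) (k + 1) - t j k) (M : ℕ) {ε : ℝ} (hε : 0 < ε) :
    ∃ C, 0 ≤ C ∧ ∀ i : ℤ, ‖block t (window M i)‖ ≤ ε * |(i : ℝ)| + C := by
  refine exists_le_mul_abs_add (g := fun i => ‖proj (window M i) * x * proj (window M i)‖)
    (fun i => ?_) (by simpa using (tendsto_compress_window hc M).norm) hε
  rw [← conjU_block_sub hx, ← norm_conjU (block t (window M (i + 1)))]
  exact abs_norm_sub_norm_le _ _

/-! ### Commutators of averaged blocks with diagonal operators and with the shift -/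

/-- The average of the blocks of an infinite matrix in windows of length `M`, weighted by a tent
function of width `N`. -/
def blockAvg (t : ℤ → ℤ → ℂ) (M N : ℕ) : Op :=
  ∑ i ∈ Finset.Ico (-(N : ℤ)) N, ((tent N i / M : ℝ) : ℂ) • block t (window M i)

theorem blockAvg_mem (t : ℤ → ℤ → ℂ) (M N : ℕ) : blockAvg t M N ∈ Apol :=
  sum_mem fun _ _ => Apol.smul_mem (block_mem _ _) _

/-- A commutator with a diagonal operator acts entry by entry, so it passes through each block
without error. -/
theorem blockAvg_mul_diag_sub {t : ℤ → ℤ → ℂ} {b : BddSeq} {y : Op}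
    (hy : ∀ j k, coef y j k = (b k - b j) * t j k) (M N : ℕ) :
    blockAvg t M N * diag b - diag b * blockAvg t M N = windowAvg M N y := by
  rw [blockAvg, windowAvg_apply, Finset.sum_mul, Finset.mul_sum, ← Finset.sum_sub_distrib]
  refine Finset.sum_congr rfl fun i _ => ?_
  rw [smul_mul_assoc, mul_smul_comm, ← smul_sub]
  congr 1
  refine coef_ext fun j k => ?_
  simp only [coef_sub, coef_mul_diag, coef_diag_mul, coef_block, coef_mul_proj, coef_proj_mul, hy]
  split_ifs <;> simp_all
  ring

theorem sum_Ico_add_one_eq {V : Type*} [AddCommGroup V] (G : ℤ → V) (N : ℕ) (h₁ : G N = 0)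
    (h₂ : G (-N) = 0) :
    ∑ i ∈ Finset.Ico (-(N : ℤ)) N, G (i + 1) = ∑ i ∈ Finset.Ico (-(N : ℤ)) N, G i := by
  rw [Finset.sum_Ico_add']
  trans ∑ i ∈ Finset.Icc (-(N : ℤ)) N, G i
  · refine Finset.sum_subset (fun i hi => ?_) fun i hi hi' => ?_
    · rw [Finset.mem_Ico] at hi; rw [Finset.mem_Icc]; omega
    · rw [Finset.mem_Icc] at hi; rw [Finset.mem_Ico] at hi'
      rw [show i = -N by omega, h₂]
  · refine (Finset.sum_subset (fun i hi => ?_) fun i hi hi' => ?_).symm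
    · rw [Finset.mem_Ico] at hi; rw [Finset.mem_Icc]; omega
    · rw [Finset.mem_Icc] at hi; rw [Finset.mem_Ico] at hi'
      rw [show i = N by omega, h₁]

/-- Summation by parts: conjugation moves window `i + 1` to window `i`, and the boundary terms
vanish because the tent is zero at `±N`. -/
theorem conjU_blockAvg_sub {t : ℤ → ℤ → ℂ} {x : Op}
    (hx : ∀ j k, coef x j k = t (j + 1) (k + 1) - t j k) (M : ℕ) {N : ℕ} (hN : 0 < N) :
    conjU (blockAvg t M N) - blockAvg t M N = windowAvg M N x +
      ∑ i ∈ Finset.Ico (-(N : ℤ)) N, proj (window M i) *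
        (((((tent N (i + 1) - tent N i) / M : ℝ) : ℂ)) • conjU (block t (window M (i + 1)))) *
        proj (window M i) := by
  have e : conjU (blockAvg t M N) = ∑ i ∈ Finset.Ico (-(N : ℤ)) N,
      ((tent N (i + 1) / M : ℝ) : ℂ) • conjU (block t (window M (i + 1))) := by
    rw [sum_Ico_add_one_eq (fun i => ((tent N i / M : ℝ) : ℂ) • conjU (block t (window M i)))]
    · simp only [conjU, blockAvg, Finset.mul_sum, Finset.sum_mul, smul_mul_assoc, mul_smul_comm]
    · rw [tent_self hN]; simp
    · rw [tent_neg_self hN]; simp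
  rw [e, blockAvg, windowAvg_apply, ← Finset.sum_sub_distrib, ← Finset.sum_add_distrib]
  refine Finset.sum_congr rfl fun i _ => ?_
  rw [mul_smul_comm, smul_mul_assoc, compress_conjU_block, ← conjU_block_sub hx, sub_div,
    Complex.ofReal_sub]
  module

/-- The slope `1/N` of the tent meets blocks of norm at most `εN + C`, while `1/M` cancels the
overlap. -/
theorem norm_conjU_blockAvg_sub_le {t : ℤ → ℤ → ℂ} {x : Op}
    (hx : ∀ j k, coef x j k = t (j + 1) (k + 1) - t j k) {M N : ℕ} (hM : 0 < M) (hN : 0 < N)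
    {ε C : ℝ} (hε : 0 ≤ ε) (hC : 0 ≤ C)
    (hB : ∀ i : ℤ, ‖block t (window M i)‖ ≤ ε * |(i : ℝ)| + C) :
    ‖conjU (blockAvg t M N) - blockAvg t M N - windowAvg M N x‖ ≤ ε + C / N := by
  rw [conjU_blockAvg_sub hx M hN, add_sub_cancel_left]
  have hM' : (0 : ℝ) < M := by exact_mod_cast hM
  have hN' : (0 : ℝ) < N := by exact_mod_cast hN
  refine (norm_sum_compress_le _ (window M) M (card_filter_mem_window_le _ M) _ ((ε + C / N) / M)
    (by positivity) fun i hi => ?_).trans_eq (mul_div_cancel₀ _ hM'.ne')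
  rw [norm_smul, norm_conjU, Complex.norm_real, Real.norm_eq_abs, abs_div, Nat.abs_cast,
    div_mul_eq_mul_div]
  refine div_le_div_of_nonneg_right ?_ hM'.le
  have hi' : |((i + 1 : ℤ) : ℝ)| ≤ N := by
    rw [Finset.mem_Ico] at hi
    rw [← Int.cast_abs]
    exact_mod_cast abs_le.2 ⟨by omega, by omega⟩
  calc _ ≤ 1 / (N : ℝ) * (ε * N + C) :=
        mul_le_mul (abs_tent_sub_le N i) ((hB _).trans (by gcongr)) (norm_nonneg _) (by positivity)
    _ = ε + C / N := by field_simp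

/-- If `x` is compact and is formally `U⁻¹ t U - t`, for an infinite matrix `t`, then averages of
blocks of `t` can be chosen that realize `x` and all other compact commutators in the limit. -/
theorem exists_blockAvg_tendsto {t : ℤ → ℤ → ℂ} {x : Op} (hc : IsCompactOperator x)
    (hx : ∀ j k, coef x j k = t (j + 1) (k + 1) - t j k) :
    ∃ N : ℕ → ℕ,
      Tendsto (fun m => conjU (blockAvg t (m + 1) (N m)) - blockAvg t (m + 1) (N m)) atTop (𝓝 x) ∧
      ∀ (b : BddSeq) (y : Op), IsCompactOperator y → (∀ j k, coef y j k = (b k - b j) * t j k) →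
        Tendsto (fun m => blockAvg t (m + 1) (N m) * diag b - diag b * blockAvg t (m + 1) (N m))
          atTop (𝓝 y) := by
  have key : ∀ m : ℕ, ∃ N : ℕ, (m + 1) ^ 2 ≤ N ∧
      ‖conjU (blockAvg t (m + 1) N) - blockAvg t (m + 1) N - windowAvg (m + 1) N x‖ ≤
        2 * (1 / ((m : ℝ) + 1)) := by
    intro m
    have hε : (0 : ℝ) < 1 / ((m : ℝ) + 1) := by positivity
    obtain ⟨C, hC, hB⟩ := exists_norm_block_le hc hx (m + 1) hε
    obtain ⟨n, hn⟩ := exists_nat_ge (C * (m + 1))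
    -- `C` depends on the window length, so `N` is chosen last: `n` makes `C/N ≤ 1/(m + 1)`, and the
    -- square is what `tendsto_windowAvg` needs.
    refine ⟨n + (m + 1) ^ 2, by omega, ?_⟩
    refine (norm_conjU_blockAvg_sub_le hx (Nat.succ_pos m) (by positivity) hε.le hC hB).trans ?_
    rw [two_mul]
    refine add_le_add le_rfl ((div_le_div_iff₀ (by positivity) (by positivity)).2 ?_)
    push_cast
    have : (0 : ℝ) ≤ ((m : ℝ) + 1) ^ 2 := by positivity
    linarith
  choose N hN hNx using key
  refine ⟨N, ?_, fun b y hcy hy => ?_⟩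
  · have h0 := (tendsto_one_div_add_atTop_nhds_zero_nat (𝕜 := ℝ)).const_mul 2
    rw [mul_zero] at h0
    have h := (squeeze_zero_norm hNx h0).add (tendsto_windowAvg hN hc)
    rw [zero_add] at h
    exact h.congr fun m => sub_add_cancel _ _
  · exact (tendsto_windowAvg hN hcy).congr fun m => (blockAvg_mul_diag_sub hy _ _).symm

/-! ### Derivations with compact values are approximately inner -/

theorem zpow_mem_Apol (n : ℤ) : ((U ^ n : unitary Op) : Op) ∈ Apol := by
  refine Submodule.subset_span ⟨n, 1, ⟨0, 1, 1, fun _ _ => rfl, fun _ _ => rfl⟩, ?_⟩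
  exact coef_ext fun j k => by simp

theorem diag_mem_Apol {b : BddSeq} (hb : b ∈ cEv) : diag b ∈ Apol :=
  Submodule.subset_span ⟨0, b, hb, by simp⟩

theorem coef_mul_matUnit (x : Op) (k j : ℤ) : coef (x * matUnit k 0) j 0 = coef x j k := by
  rw [coef, mul_apply_eq_comp, matUnit_E, if_pos rfl]
  rfl

theorem deriv_one (d : Deriv incl) : d 1 = 0 := by
  have h := d.leibniz 1 1
  rw [mul_one (1 : Apol), map_one incl, mul_one, one_mul] at h
  exact left_eq_add.1 h

/-- The infinite matrix `t` for which `d` is formally the commutator with `t`. -/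
def implMatrix (d : Deriv incl) (j k : ℤ) : ℂ := coef (d ⟨matUnit k 0, matUnit_mem k 0⟩ : Op) j 0

/-- Column `0` of the Leibniz rule for `x * matUnit k 0`. The subtracted term is the entry `(j, k)`
of the formal product `x t`, so this reads `d(x) = tx - xt`. -/
theorem coef_deriv (d : Deriv incl) (x : Apol) {k l : ℤ} {r : ℂ}
    (hx : (x : Op) * matUnit k 0 = r • matUnit l 0) (j : ℤ) :
    coef (d x : Op) j k = r * implMatrix d j l -
      coef ((x : Op) * (d ⟨matUnit k 0, matUnit_mem k 0⟩ : Op)) j 0 := by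
  have h := d.leibniz x ⟨matUnit k 0, matUnit_mem k 0⟩
  have e : x * ⟨matUnit k 0, matUnit_mem k 0⟩ = r • (⟨matUnit l 0, matUnit_mem l 0⟩ : Apol) :=
    Subtype.ext hx
  rw [e, map_smul] at h
  have h' : r • (d ⟨matUnit l 0, matUnit_mem l 0⟩ : Op) = (d x : Op) * matUnit k 0 +
      (x : Op) * (d ⟨matUnit k 0, matUnit_mem k 0⟩ : Op) := congrArg Subtype.val h
  rw [← coef_mul_matUnit, eq_sub_iff_add_eq, ← coef_add, ← h', coef_smul]
  rfl

theorem coef_deriv_U (d : Deriv incl) (j k : ℤ) :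
    coef (((U ^ (-1 : ℤ) : unitary Op) : Op) * (d ⟨_, zpow_mem_Apol 1⟩ : Op)) j k =
      implMatrix d (j + 1) (k + 1) - implMatrix d j k := by
  rw [coef_zpow_mul, coef_deriv d _ (l := k + 1) (r := 1) (coef_ext fun i l => ?_), one_mul,
    coef_zpow_mul, sub_neg_eq_add, add_sub_cancel_right]
  · rfl
  · rw [coef_zpow_mul, coef_smul, coef_matUnit, coef_matUnit]
    simp only [sub_eq_iff_eq_add, one_mul]

theorem coef_deriv_diag (d : Deriv incl) {b : BddSeq} (hb : b ∈ cEv) (j k : ℤ) :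
    coef (d ⟨_, diag_mem_Apol hb⟩ : Op) j k = (b k - b j) * implMatrix d j k := by
  rw [coef_deriv d _ (l := k) (r := b k) (coef_ext fun i l => ?_), coef_diag_mul, sub_mul]
  · rfl
  · rw [coef_diag_mul, coef_smul, coef_matUnit]
    split_ifs with h
    · rw [h.1]
    · simp

/-! ### From convergence at the generators to convergence on `𝒜` -/

/-- The sequence of commutators with `s n` converges to `d` at `x`. -/
def ConvergesAt (d : Deriv incl) (s : ℕ → A) (x : Apol) : Prop :=
  Tendsto (fun n => s n * incl x - incl x * s n) atTop (𝓝 (d x))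

namespace ConvergesAt

variable {d : Deriv incl} {s : ℕ → A} {x y : Apol}

theorem add (hx : ConvergesAt d s x) (hy : ConvergesAt d s y) : ConvergesAt d s (x + y) := by
  have h := Tendsto.add hx hy
  rw [← map_add] at h
  refine h.congr fun n => ?_
  rw [map_add]
  noncomm_ring

theorem smul (r : ℂ) (hx : ConvergesAt d s x) : ConvergesAt d s (r • x) := by
  have h := Tendsto.const_smul hx r
  rw [← map_smul] at h
  refine h.congr fun n => ?_
  rw [map_smul, mul_smul_comm, smul_mul_assoc, smul_sub]

theorem zero : ConvergesAt d s 0 := by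
  rw [ConvergesAt, map_zero, map_zero]
  simp

theorem one : ConvergesAt d s 1 := by
  rw [ConvergesAt, deriv_one, map_one]
  simp

theorem mul (hx : ConvergesAt d s x) (hy : ConvergesAt d s y) : ConvergesAt d s (x * y) := by
  have h := (Tendsto.mul_const (incl y) hx).add (Tendsto.const_mul (incl x) hy)
  rw [← d.leibniz] at h
  refine h.congr fun n => ?_
  rw [map_mul]
  noncomm_ring

/-- Both `d` and the commutators send an inverse `y` of `x` to minus `y`, times the value at `x`,
times `y`. -/
theorem inv (hx : ConvergesAt d s x) (hxy : x * y = 1) (hyx : y * x = 1) :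
    ConvergesAt d s y := by
  have h := ((Tendsto.mul_const (incl y) hx).const_mul (incl y)).neg
  have exy : incl x * incl y = 1 := by rw [← map_mul, hxy, map_one]
  have eyx : incl y * incl x = 1 := by rw [← map_mul, hyx, map_one]
  have e : ∀ z : A, incl y * (incl x * z) = z := fun z => by rw [← mul_assoc, eyx, one_mul]
  have ed : -(incl y * (d x * incl y)) = d y := by
    have h1 := d.leibniz x y
    rw [hxy, deriv_one] at h1
    rw [eq_neg_of_add_eq_zero_left h1.symm, mul_neg, neg_neg, e]
  rw [ed] at h
  refine h.congr fun n => ?_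
  rw [sub_mul, mul_sub, mul_assoc (s n), exy, mul_one, mul_assoc (incl x), e, neg_sub]

theorem zpow (hU : ConvergesAt d s ⟨_, zpow_mem_Apol 1⟩) (n : ℤ) :
    ConvergesAt d s ⟨_, zpow_mem_Apol n⟩ := by
  have hmul : ∀ m n : ℤ, (⟨_, zpow_mem_Apol (m + n)⟩ : Apol) =
      ⟨_, zpow_mem_Apol m⟩ * ⟨_, zpow_mem_Apol n⟩ := fun m n =>
    Subtype.ext (show ((U ^ (m + n) : unitary Op) : Op) =
      ((U ^ m : unitary Op) : Op) * ((U ^ n : unitary Op) : Op) by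
        rw [zpow_add, Submonoid.coe_mul])
  have h0 : (⟨_, zpow_mem_Apol 0⟩ : Apol) = 1 := Subtype.ext (by simp)
  have hV : ConvergesAt d s ⟨_, zpow_mem_Apol (-1)⟩ :=
    inv hU (by rw [← hmul]; exact h0) (by rw [← hmul]; exact h0)
  induction n with
  | zero => rw [h0]; exact one
  | succ n ih => rw [hmul]; exact ih.mul hU
  | pred n ih => rw [sub_eq_add_neg, hmul]; exact ih.mul hV

end ConvergesAt

theorem isApproxInner_of_convergesAt {d : Deriv incl} {s : ℕ → A}
    (hU : ConvergesAt d s ⟨_, zpow_mem_Apol 1⟩)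
    (hd : ∀ (b : BddSeq) (hb : b ∈ cEv), ConvergesAt d s ⟨_, diag_mem_Apol hb⟩) :
    IsApproxInner d := by
  have key : ∀ x ∈ Submodule.span ℂ monomials, ∃ y : Apol, (y : Op) = x ∧ ConvergesAt d s y := by
    intro x hx
    induction hx using Submodule.span_induction with
    | mem x hx =>
      obtain ⟨n, b, hb, rfl⟩ := hx
      exact ⟨_, rfl, (ConvergesAt.zpow hU n).mul (hd b hb)⟩
    | zero => exact ⟨0, rfl, ConvergesAt.zero⟩
    | add x y _ _ hx hy =>
      obtain ⟨x, rfl, hx⟩ := hx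
      obtain ⟨y, rfl, hy⟩ := hy
      exact ⟨_, rfl, hx.add hy⟩
    | smul r x _ hx =>
      obtain ⟨x, rfl, hx⟩ := hx
      exact ⟨_, rfl, hx.smul r⟩
  refine ⟨s, fun x => ?_⟩
  obtain ⟨y, hy, h⟩ := key x x.2
  rw [← Subtype.ext hy]
  exact h

theorem isApproxInner_of_forall_mem_K {d : Deriv incl} (hd : ∀ x, d x ∈ K) : IsApproxInner d := by
  have hinv : ((U ^ (1 : ℤ) : unitary Op) : Op) * ((U ^ (-1 : ℤ) : unitary Op) : Op) = 1 := by
    rw [← Submonoid.coe_mul, ← zpow_add]; simp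
  obtain ⟨N, hNU, hNd⟩ := exists_blockAvg_tendsto (t := implMatrix d)
    (IsCompactOperator.clm_comp (hd ⟨_, zpow_mem_Apol 1⟩) ((U ^ (-1 : ℤ) : unitary Op) : Op))
    (coef_deriv_U d)
  refine isApproxInner_of_convergesAt
    (s := fun m => ⟨_, Apol_le_A (blockAvg_mem (implMatrix d) (m + 1) (N m))⟩) ?_ fun b hb => ?_
  · refine tendsto_subtype_rng.2 ?_
    -- The block averages were fitted to `U⁻¹ d(U)`; multiplying by `U` turns `U⁻¹ s U - s` into `s
    -- U - U s`.
    have h := hNU.const_mul ((U ^ (1 : ℤ) : unitary Op) : Op)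
    have e : ((U ^ (1 : ℤ) : unitary Op) : Op) * (((U ^ (-1 : ℤ) : unitary Op) : Op) *
        (d ⟨_, zpow_mem_Apol 1⟩ : Op)) = d ⟨_, zpow_mem_Apol 1⟩ := by
      rw [← mul_assoc, hinv, one_mul]
    have h' := e ▸ h
    refine h'.congr fun m => ?_
    rw [conjU, mul_sub, mul_assoc, ← mul_assoc, hinv, one_mul]
    rfl
  · exact tendsto_subtype_rng.2 (hNd b _ (hd _) (coef_deriv_diag d hb))

/-! ### The quotient `A/𝒦` is commutative -/

theorem isCompactOperator_diag {b : BddSeq} (hb : Tendsto (fun k => b k) cofinite (𝓝 0)) :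
    IsCompactOperator (diag b) := by
  have hcl := isClosed_setOfPred_isCompactOperator (𝕜₁ := ℂ) (𝕜₂ := ℂ) (σ₁₂ := RingHom.id ℂ)
    (M₁ := Hilb) (M₂ := Hilb)
  refine hcl.closure_subset (Metric.mem_closure_iff.2 fun ε hε => ?_)
  have hfin := Filter.eventually_cofinite.1 (Metric.tendsto_nhds.1 hb (ε / 2) (by positivity))
  obtain ⟨R, hR⟩ : ∃ R : ℕ, ∀ k : ℤ, R ≤ k.natAbs → ‖b k‖ < ε / 2 := by
    refine ⟨∑ l ∈ hfin.toFinset, (l.natAbs + 1), fun i hi => ?_⟩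
    by_contra h
    have hmem : i ∈ hfin.toFinset := by simpa using h
    have := Finset.single_le_sum (f := fun l : ℤ => l.natAbs + 1) (fun _ _ => Nat.zero_le _) hmem
    omega
  refine ⟨diag b * diag (cut R), IsCompactOperator.clm_comp (diag_cut_compact R) (diag b), ?_⟩
  rw [dist_eq_norm]
  refine lt_of_le_of_lt (b := ε / 2) ?_ (by linarith)
  refine ContinuousLinearMap.opNorm_le_bound _ (by positivity) fun f => ?_
  have hn : ‖((ε / 2 : ℝ) : ℂ) • f‖ = ε / 2 * ‖f‖ := by
    rw [norm_smul, Complex.norm_real, Real.norm_of_nonneg (by positivity)]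
  rw [← hn]
  refine lp.norm_mono (by norm_num) fun k => ?_
  change ‖b k * f k - b k * ((cut R : ℤ → ℂ) k * f k)‖ ≤ ‖((ε / 2 : ℝ) : ℂ) * f k‖
  rw [cut_apply, norm_mul, Complex.norm_real, Real.norm_of_nonneg (by positivity)]
  split_ifs with h
  · rw [one_mul, sub_self, norm_zero]; positivity
  · rw [zero_mul, mul_zero, sub_zero, norm_mul]
    exact mul_le_mul_of_nonneg_right (hR k (by omega)).le (norm_nonneg _)

/-- The commutator is `Uⁿ` times the diagonal of `a(k + n) - a(k)`, which tends to zero at each end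
because `a` has a limit there; the two limits need not agree. -/
theorem isCompactOperator_diag_commutator {a : BddSeq} (ha : a ∈ c) (n : ℤ) :
    IsCompactOperator (diag a * ((U ^ n : unitary Op) : Op) -
      ((U ^ n : unitary Op) : Op) * diag a : Op) := by
  have hmem : Memℓp (fun k : ℤ => a (k + n)) ∞ := by
    refine memℓp_infty ⟨‖a‖, ?_⟩
    rintro _ ⟨k, rfl⟩
    exact lp.norm_apply_le_norm (by simp) a _
  let b : BddSeq := ⟨_, hmem⟩ - a
  have hb : Tendsto (fun k => b k) cofinite (𝓝 0) := by
    obtain ⟨⟨p, hp⟩, ⟨q, hq⟩⟩ := ha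
    rw [Int.cofinite_eq]
    refine Tendsto.sup ?_ ?_
    · have h := (hq.comp (tendsto_atBot_add_const_right _ n tendsto_id)).sub hq
      rw [sub_self] at h
      exact h
    · have h := (hp.comp (tendsto_atTop_add_const_right _ n tendsto_id)).sub hp
      rw [sub_self] at h
      exact h
  have e : diag a * ((U ^ n : unitary Op) : Op) - ((U ^ n : unitary Op) : Op) * diag a =
      ((U ^ n : unitary Op) : Op) * diag b := by
    refine op_ext fun k => ?_
    change diag a (((U ^ n : unitary Op) : Op) (E k)) - ((U ^ n : unitary Op) : Op) (diag a (E k)) =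
      ((U ^ n : unitary Op) : Op) (diag b (E k))
    rw [diag_E, diag_E, map_smul, map_smul, U_zpow_E, diag_E, ← sub_smul]
    rfl
  rw [e]
  exact IsCompactOperator.clm_comp (isCompactOperator_diag hb) ((U ^ n : unitary Op) : Op)

/-- The operators that commute with `y` modulo the compact operators. -/
def essCommutant (y : Op) : Subalgebra ℂ Op where
  carrier := {x | IsCompactOperator (x * y - y * x : Op)}
  mul_mem' {x z} hx hz := by
    have e : x * z * y - y * (x * z) = x * (z * y - y * z) + (x * y - y * x) * z := by noncomm_ring
    change IsCompactOperator (x * z * y - y * (x * z) : Op)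
    rw [e]
    exact (IsCompactOperator.clm_comp hz x).add (IsCompactOperator.comp_clm hx z)
  add_mem' {x z} hx hz := by
    have e : (x + z) * y - y * (x + z) = (x * y - y * x) + (z * y - y * z) := by noncomm_ring
    change IsCompactOperator ((x + z) * y - y * (x + z) : Op)
    rw [e]
    exact IsCompactOperator.add hx hz
  algebraMap_mem' r := by
    change IsCompactOperator (algebraMap ℂ Op r * y - y * algebraMap ℂ Op r : Op)
    rw [Algebra.commutes, sub_self]
    exact isCompactOperator_zero

theorem mem_essCommutant {x y : Op} :
    x ∈ essCommutant y ↔ IsCompactOperator (x * y - y * x : Op) := Iff.rfl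

theorem mem_essCommutant_of_commute {x y : Op} (h : Commute x y) : x ∈ essCommutant y := by
  rw [mem_essCommutant, h.eq, sub_self]
  exact isCompactOperator_zero

theorem mem_essCommutant_comm {x y : Op} (h : x ∈ essCommutant y) : y ∈ essCommutant x := by
  rw [mem_essCommutant] at h ⊢
  rw [← neg_sub]
  exact h.neg

theorem isClosed_essCommutant (y : Op) : IsClosed (essCommutant y : Set Op) := by
  have hcl := isClosed_setOfPred_isCompactOperator (𝕜₁ := ℂ) (𝕜₂ := ℂ) (σ₁₂ := RingHom.id ℂ)
    (M₁ := Hilb) (M₂ := Hilb)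
  exact hcl.preimage (f := fun x : Op => x * y - y * x) (by fun_prop)

/-- The powers of `U` and the diagonal operators, which generate `A` without taking adjoints. -/
def generators : Set Op := Set.range (fun n : ℤ => ((U ^ n : unitary Op) : Op)) ∪ diag '' c

theorem star_diag (a : BddSeq) : star (diag a) = diag (star a) := by
  rw [ContinuousLinearMap.star_eq_adjoint, eq_comm, ContinuousLinearMap.eq_adjoint_iff]
  intro f g
  rw [lp.inner_eq_tsum, lp.inner_eq_tsum]
  refine tsum_congr fun k => ?_
  rw [diag_apply, diag_apply, lp.star_apply]
  simp
  ring

theorem star_mem_c {a : BddSeq} (ha : a ∈ c) : star a ∈ c := by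
  obtain ⟨⟨p, hp⟩, ⟨q, hq⟩⟩ := ha
  exact ⟨⟨star p, hp.star⟩, ⟨star q, hq.star⟩⟩

/-- The set `generators` contains the adjoints of the original generators, so `S` need not be
assumed stable under adjoints. This allows `S = essCommutant y`. -/
theorem A_le_of_generators {S : Subalgebra ℂ Op} (hS : IsClosed (S : Set Op))
    (h : generators ⊆ S) : A.toSubalgebra ≤ S := by
  have h1 : (StarAlgebra.adjoin ℂ (insert (U : Op) (diag '' c))).toSubalgebra ≤ S := by
    rw [StarAlgebra.adjoin_toSubalgebra, Algebra.adjoin_le_iff]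
    refine Set.Subset.trans ?_ h
    rintro x (hx | hx)
    · rcases hx with rfl | hx
      · exact Or.inl ⟨1, by simp⟩
      · exact Or.inr hx
    · rw [Set.mem_star] at hx
      rcases hx with hx | ⟨a, ha, hx⟩
      · refine Or.inl ⟨-1, ?_⟩
        change ((U ^ (-1 : ℤ) : unitary Op) : Op) = x
        rw [← star_star x, hx, zpow_neg_one, ← Unitary.star_eq_inv, Unitary.coe_star]
      · refine Or.inr ⟨star a, star_mem_c ha, ?_⟩
        rw [← star_diag, hx, star_star]
  exact fun x hx => closure_minimal h1 hS hx

theorem generators_subset_essCommutant {y : Op} (hy : y ∈ generators) :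
    generators ⊆ essCommutant y := by
  rintro x (⟨m, rfl⟩ | ⟨a, ha, rfl⟩) <;> rcases hy with ⟨n, rfl⟩ | ⟨b, hb, rfl⟩
  · exact mem_essCommutant_of_commute
      (((Commute.refl U).zpow_zpow m n).map (unitary Op).subtype)
  · exact mem_essCommutant_comm (isCompactOperator_diag_commutator hb m)
  · exact isCompactOperator_diag_commutator ha n
  · refine mem_essCommutant_of_commute (coef_ext fun j k => ?_)
    rw [coef_diag_mul, coef_diag_mul, coef, coef, diag_E, diag_E, lp.coeFn_smul, lp.coeFn_smul,
      Pi.smul_apply, Pi.smul_apply, E_apply]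
    split_ifs with h
    · rw [h]; simp only [smul_eq_mul]; ring
    · simp

/-- The generators essentially commute with each other. Closedness extends this to `A` in one
variable, then, by symmetry, in the other. -/
theorem commutator_mem_K (x y : A) : x * y - y * x ∈ K := by
  have h : ∀ z ∈ generators, z ∈ essCommutant (y : Op) := fun z hz =>
    mem_essCommutant_comm (A_le_of_generators (isClosed_essCommutant z)
      (generators_subset_essCommutant hz) y.2)
  exact A_le_of_generators (isClosed_essCommutant y) h x.2

theorem forall_mem_K_of_isApproxInner {d : Deriv incl} (h : IsApproxInner d) (x : Apol) :
    d x ∈ K := by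
  obtain ⟨s, hs⟩ := h
  have hcl := isClosed_setOfPred_isCompactOperator (𝕜₁ := ℂ) (𝕜₂ := ℂ) (σ₁₂ := RingHom.id ℂ)
    (M₁ := Hilb) (M₂ := Hilb)
  exact hcl.mem_of_tendsto ((continuous_subtype_val.tendsto _).comp (hs x))
    (Eventually.of_forall fun n => commutator_mem_K (s n) (incl x))

theorem induced_eq_zero_iff {d : Deriv incl} : induced d = 0 ↔ ∀ x, d x ∈ K := by
  refine ⟨fun h x => ?_, fun h => Deriv.ext fun y => ?_⟩
  · rw [← Ideal.Quotient.eq_zero_iff_mem, ← induced_apply, h, Deriv.zero_apply]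
  · obtain ⟨x, rfl⟩ := (Deriv.cls incl K).rangeRestrict_surjective y
    exact (induced_apply d x).trans (Ideal.Quotient.eq_zero_iff_mem.2 (h x))

theorem induced_eq_zero_iff_isApproxInner (d : Deriv incl) : induced d = 0 ↔ IsApproxInner d :=
  induced_eq_zero_iff.trans ⟨isApproxInner_of_forall_mem_K, forall_mem_K_of_isApproxInner⟩

theorem isApproxInner_sub {d₁ d₂ : Deriv incl} (h : induced d₁ = induced d₂) :
    IsApproxInner (d₁ - d₂) := by
  refine isApproxInner_of_forall_mem_K fun x => ?_
  rw [Deriv.sub_apply, ← Ideal.Quotient.eq, ← induced_apply, ← induced_apply, h]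

end QuantumCylinder

end

open QuantumCylinder in
theorem mainTheorem4 :
    (∀ d : Deriv incl, induced d = 0 ↔ IsApproxInner d) ∧
    (∀ d₁ d₂ : Deriv incl, induced d₁ = induced d₂ → IsApproxInner (d₁ - d₂)) :=
  ⟨induced_eq_zero_iff_isApproxInner, fun _ _ => isApproxInner_sub⟩
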